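/- Let $\lambda P2$ be second order dependent type theory: pseudo-terms $T ::= \star \mid \mathsf{Kind} \mid x \mid \Pi x{:}T.\,T \mid \lambda x{:}T.\,T \mid T\,T$, with the axiom $\star:\mathsf{Kind}$, the usual rules for variables, weakening, abstraction and application, conversion by $\beta$-equality, and the formation of $\Pi x{:}U.\,T : s_2$ from $U:s_1$ and $T:s_2$ for all pairs of sorts $(s_1,s_2)\neq(\mathsf{Kind},\mathsf{Kind})$. A type is called inhabited if it is the type of a closed term. Write $\mathsf{bool}:=\Pi\alpha{:}\star.\,\alpha\to\alpha\to\alpha$, $\mathsf{true}:=\lambda\alpha{:}\star.\lambda x,y{:}\alpha.\,x$, $\mathsf{false}:=\lambda\alpha{:}\star.\lambda x,y{:}\alpha.\,y$, $\neg:=\lambda b{:}\mathsf{bool}.\,b\,\mathsf{bool}\,\mathsf{false}\,\mathsf{true}$, $\mathsf I:=\lambda b{:}\mathsf{bool}.\,b$; let $t=_\sigma q:=\Pi P{:}\sigma\to\star.\,P\,t\to P\,q$ be Leibniz equality, $\sigma\times\tau:=\Pi\gamma{:}\star.(\sigma\to\tau\to\gamma)\to\gamma$ the definable product (also used as conjunction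 $\wedge$), and $\exists\alpha{:}K.\,B:=\Pi\beta{:}\star.(\Pi\alpha{:}K.\,B\to\beta)\to\beta$ the definable existential. For a type $\sigma$ let $\mathsf{Stream}_\sigma:=\exists\alpha{:}\star.\ \alpha\times(\alpha\to\sigma)\times(\alpha\to\alpha)$, where $\mathsf{pack}\ \tau\ f:=\lambda\beta{:}\star.\lambda k.\,k\,\tau\,f$ introduces an existential, $\mathsf{hd}\ s:=s\ \sigma\ (\lambda\alpha.\lambda\langle x,h,t\rangle.\,h\,x)$ and $\mathsf{tl}\ s:=s\ \mathsf{Stream}_\sigma\ (\lambda\alpha.\lambda\langle x,h,t\rangle.\,\mathsf{pack}\ \alpha\ \langle t\,x,h,t\rangle)$. A relation $R:\mathsf{Stream}_\sigma\to\mathsf{Stream}_\sigma\to\star$ is a bisimulation if it is symmetric and $R\,x\,y$ implies $\mathsf{hd}\,x=_\sigma\mathsf{hd}\,y$ and $R\,(\mathsf{tl}\,x)\,(\mathsf{tl}\,y)$; these conditions are expressed as a type. Let $s\sim t$ be the type $\exists R{:}\mathsf{Stream}_\sigma\to\mathsf{Stream}_\sigma\to\star.\ (R\text{ is a bisimulation}\wedge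 R\,s\,t)$. The coinduction principle for $\mathsf{Stream}_\sigma$ is the type $\Pi s,t{:}\mathsf{Stream}_\sigma.\ s\sim t\to s=_{\mathsf{Stream}_\sigma}t$. Theorem. The definable streams of $\lambda P2$ have no coinduction principle: for $\sigma=\mathsf{bool}$ the coinduction principle is a well-formed closed type that is not inhabited. Concretely, for the closed terms $s_1:=\mathsf{pack}\ \mathsf{bool}\ \langle\mathsf{true},\neg,\neg\rangle$ and $s_2:=\mathsf{pack}\ \mathsf{bool}\ \langle\mathsf{false},\mathsf I,\neg\rangle$ of type $\mathsf{Stream}_{\mathsf{bool}}$, the type $s_1\sim s_2$ is inhabited, but the well-formed closed type $s_1=_{\mathsf{Stream}_{\mathsf{bool}}}s_2$ is not. This holds both if the product in the stream type is the definable product above and if the stream type is written out in the curried form $\Pi\beta{:}\star.(\Pi\alpha{:}\star.\,\alpha\to(\alpha\to\sigma)\to(\alpha\to\alpha)\to\beta)\to\beta$, with $\mathsf{pack}\ \alpha\ \langle x,h,t\rangle=\lambda\beta{:}\star.\lambda k.\,k\,\alpha\,x\,h\,t$ and $\mathsf{hd}$, $\mathsf{tl}$ taken accordingly. -/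

import Mathlib

/-! The type system `λP2` (second order dependent type theory) and the stream type definable in it.
Bound and declared variables are represented by de Bruijn indices. -/

namespace LP2

/-- The two sorts `⋆` (written `star`) and `Kind`. -/
inductive Srt : Type
  | star : Srt
  | kind : Srt
  deriving DecidableEq

/-- Pseudo-terms up to renaming of bound variables.  `var n` refers to the `n`-th enclosing binder
(or, past all the binders, to the corresponding declaration of the context); `pi U T` is
`Π x : U. T` and `lam U b` is `λ x : U. b`, where the variable `x` is index `0` in `T` and `b`. -/
inductive Tm : Type
  | sort : Srt → Tm
  | var : ℕ → Tm
  | pi : Tm → Tm → Tm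
  | lam : Tm → Tm → Tm
  | app : Tm → Tm → Tm
  deriving DecidableEq

namespace Tm

/-- Extend a renaming under one binder. -/
def upRen (r : ℕ → ℕ) : ℕ → ℕ
  | 0 => 0
  | n + 1 => r n + 1

/-- Capture-avoiding simultaneous renaming. -/
def rename : (ℕ → ℕ) → Tm → Tm
  | _, sort s => sort s
  | r, var n => var (r n)
  | r, pi U T => pi (rename r U) (rename (upRen r) T)
  | r, lam U b => lam (rename r U) (rename (upRen r) b)
  | r, app f a => app (rename r f) (rename r a)

/-- `t.shift` is `t` seen in a context with one more declaration at the end. -/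
def shift (t : Tm) : Tm := rename Nat.succ t

/-- For `t` with a distinguished last variable (index `0`), `t.shift1` is `t` seen in a context
with one more declaration just before that variable. -/
def shift1 (t : Tm) : Tm := rename (upRen Nat.succ) t

/-- Extend a substitution under one binder. -/
def upSub (s : ℕ → Tm) : ℕ → Tm
  | 0 => var 0
  | n + 1 => (s n).shift

/-- Capture-avoiding simultaneous substitution. -/
def subst : (ℕ → Tm) → Tm → Tm
  | _, sort s => sort s
  | s, var n => s n
  | s, pi U T => pi (subst s U) (subst (upSub s) T)
  | s, lam U b => lam (subst s U) (subst (upSub s) b)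
  | s, app f a => app (subst s f) (subst s a)

/-- The substitution `0 ↦ a`, `n + 1 ↦ n`. -/
def single (a : Tm) : ℕ → Tm
  | 0 => a
  | n + 1 => var n

/-- `T.inst a` is `T[x := a]`, where `x` is the variable with index `0`. -/
def inst (T a : Tm) : Tm := subst (single a) T

end Tm

open Tm

/-- One step of `β`-reduction, anywhere in a pseudo-term. -/
inductive Step : Tm → Tm → Prop
  | beta (U b a : Tm) : Step (app (lam U b) a) (b.inst a)
  | piDom {U U' : Tm} (T : Tm) : Step U U' → Step (pi U T) (pi U' T)
  | piCod (U : Tm) {T T' : Tm} : Step T T' → Step (pi U T) (pi U T')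
  | lamDom {U U' : Tm} (b : Tm) : Step U U' → Step (lam U b) (lam U' b)
  | lamBody (U : Tm) {b b' : Tm} : Step b b' → Step (lam U b) (lam U b')
  | appFun {f f' : Tm} (a : Tm) : Step f f' → Step (app f a) (app f' a)
  | appArg (f : Tm) {a a' : Tm} : Step a a' → Step (app f a) (app f a')

/-- `β`-equality: the reflexive symmetric transitive closure of `β`-reduction. -/
def BetaEq : Tm → Tm → Prop := Relation.EqvGen Step

/-- Contexts; the head of the list is the most recent declaration, and each type in the list
lives in the context given by the rest of the list. -/
abbrev Ctx : Type := List Tm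

/-- `Typing Γ M T` is the judgment `Γ ⊢ M : T` of `λP2`. -/
inductive Typing : Ctx → Tm → Tm → Prop
  | axm : Typing [] (sort .star) (sort .kind)
  | var {Γ : Ctx} {T : Tm} {s : Srt} :
      Typing Γ T (sort s) → Typing (T :: Γ) (var 0) T.shift
  | weak {Γ : Ctx} {M U T : Tm} {s : Srt} :
      Typing Γ M U → Typing Γ T (sort s) → Typing (T :: Γ) M.shift U.shift
  | conv {Γ : Ctx} {M T U : Tm} {s : Srt} :
      Typing Γ M T → Typing Γ U (sort s) → BetaEq T U → Typing Γ M U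
  | pi {Γ : Ctx} {U T : Tm} {s₁ s₂ : Srt} :
      (s₁, s₂) ≠ (Srt.kind, Srt.kind) →
      Typing Γ U (sort s₁) → Typing (U :: Γ) T (sort s₂) → Typing Γ (pi U T) (sort s₂)
  | lam {Γ : Ctx} {U T b : Tm} {s : Srt} :
      Typing Γ (Tm.pi U T) (sort s) → Typing (U :: Γ) b T → Typing Γ (lam U b) (Tm.pi U T)
  | app {Γ : Ctx} {f a U T : Tm} :
      Typing Γ f (Tm.pi U T) → Typing Γ a U → Typing Γ (app f a) (T.inst a)

/-- A type is inhabited (holds, is derivable) if it is the type of a closed term. -/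
def IsInhabited (T : Tm) : Prop := ∃ M : Tm, Typing [] M T

/-! ### Definable types and terms -/

/-- The sort `⋆`. -/
def star : Tm := sort .star

/-- `A → B`, the non-dependent product. -/
def arr (A B : Tm) : Tm := pi A B.shift

/-- `f a b`. -/
def app2 (f a b : Tm) : Tm := app (app f a) b

/-- `bool := Π α : ⋆. α → α → α`. -/
def bool : Tm := pi star (arr (var 0) (arr (var 0) (var 0)))

/-- `true := λ α : ⋆. λ x y : α. x`. -/
def tt : Tm := lam star (lam (var 0) (lam (var 1) (var 1)))

/-- `false := λ α : ⋆. λ x y : α. y`. -/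
def ff : Tm := lam star (lam (var 0) (lam (var 1) (var 0)))

/-- `¬ := λ b : bool. b bool false true`. -/
def neg : Tm := lam bool (app2 (app (var 0) bool) ff tt)

/-- `I := λ b : bool. b`. -/
def idBool : Tm := lam bool (var 0)

/-- Leibniz equality `t =_σ q := Π P : σ → ⋆. P t → P q`. -/
def leib (σ t q : Tm) : Tm :=
  pi (arr σ star) (arr (app (var 0) t.shift) (app (var 0) q.shift))

/-- The product (conjunction) `σ × τ := Π γ : ⋆. (σ → τ → γ) → γ`. -/
def prod (σ τ : Tm) : Tm :=
  pi star (arr (arr σ.shift (arr τ.shift (var 0))) (var 0))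

/-- `⟨a, b⟩ := λ γ : ⋆. λ k : σ → τ → γ. k a b`, for `a : σ` and `b : τ`. -/
def pair (σ τ a b : Tm) : Tm :=
  lam star (lam (arr σ.shift (arr τ.shift (var 0))) (app2 (var 0) a.shift.shift b.shift.shift))

/-- `π₁ p := p σ (λ x : σ. λ y : τ. x)`, for `p : σ × τ`. -/
def pr1 (σ τ p : Tm) : Tm := app2 p σ (lam σ (lam τ.shift (var 1)))

/-- `π₂ p := p τ (λ x : σ. λ y : τ. y)`, for `p : σ × τ`. -/
def pr2 (σ τ p : Tm) : Tm := app2 p τ (lam σ (lam τ.shift (var 0)))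

/-- `∃ α : K. B := Π β : ⋆. (Π α : K. B → β) → β`; the variable `α` is index `0` in `B`. -/
def ex (K B : Tm) : Tm :=
  pi star (arr (pi K.shift (arr B.shift1 (var 1))) (var 0))

/-- `pack τ f := λ β : ⋆. λ k : (Π α : ⋆. B → β). k τ f`, for `f : B[α := τ]`. -/
def pack (B τ f : Tm) : Tm :=
  lam star (lam (pi star (arr B.shift1 (var 1))) (app2 (var 0) τ.shift.shift f.shift.shift))

/-- `rec_∃ τ g t := t τ g`. -/
def recEx (τ g t : Tm) : Tm := app2 t τ g

/-! ### Streams, with the state, the head and the tail function of a stream packed in a product -/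

/-- `(α → σ) × (α → α)` for a type `α`. -/
def coalg (σ α : Tm) : Tm := prod (arr α σ) (arr α α)

/-- `α × (α → σ) × (α → α)` for a type `α`. -/
def pre (σ α : Tm) : Tm := prod α (coalg σ α)

/-- `⟨x, h, t⟩ : α × (α → σ) × (α → α)`. -/
def triple (σ α x h t : Tm) : Tm := pair α (coalg σ α) x (pair (arr α σ) (arr α α) h t)

/-- First component of `p : α × (α → σ) × (α → α)`. -/
def stateOf (σ α p : Tm) : Tm := pr1 α (coalg σ α) p

/-- Second component of `p : α × (α → σ) × (α → α)`. -/
def headOf (σ α p : Tm) : Tm := pr1 (arr α σ) (arr α α) (pr2 α (coalg σ α) p)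

/-- Third component of `p : α × (α → σ) × (α → α)`. -/
def tailOf (σ α p : Tm) : Tm := pr2 (arr α σ) (arr α α) (pr2 α (coalg σ α) p)

/-- `Stream := ∃ α : ⋆. α × (α → σ) × (α → α)`. -/
def streamP (σ : Tm) : Tm := ex star (pre σ.shift (var 0))

/-- `pack α ⟨x, h, t⟩ : Stream`. -/
def packP (σ α x h t : Tm) : Tm := pack (pre σ.shift (var 0)) α (triple σ α x h t)

/-- `hd s := rec_∃ σ (λ α. λ ⟨x, h, t⟩. h x) s`. -/
def hdP (σ s : Tm) : Tm :=
  recEx σ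
    (lam star (lam (pre σ.shift (var 0))
      (app (headOf σ.shift.shift (var 1) (var 0)) (stateOf σ.shift.shift (var 1) (var 0))))) s

/-- `tl s := rec_∃ Stream (λ α. λ ⟨x, h, t⟩. pack α ⟨t x, h, t⟩) s`. -/
def tlP (σ s : Tm) : Tm :=
  recEx (streamP σ)
    (lam star (lam (pre σ.shift (var 0))
      (packP σ.shift.shift (var 1)
        (app (tailOf σ.shift.shift (var 1) (var 0)) (stateOf σ.shift.shift (var 1) (var 0)))
        (headOf σ.shift.shift (var 1) (var 0))
        (tailOf σ.shift.shift (var 1) (var 0))))) s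

/-! ### Streams, in curried form -/

/-- `Π α : ⋆. α → (α → σ) → (α → α) → β`. -/
def contC (σ β : Tm) : Tm :=
  pi star (arr (var 0) (arr (arr (var 0) σ.shift) (arr (arr (var 0) (var 0)) β.shift)))

/-- `Stream := Π β : ⋆. (Π α : ⋆. α → (α → σ) → (α → α) → β) → β`. -/
def streamC (σ : Tm) : Tm := pi star (arr (contC σ.shift (var 0)) (var 0))

/-- `pack α ⟨x, h, t⟩ := λ β : ⋆. λ k : (Π α : ⋆. α → (α → σ) → (α → α) → β). k α x h t`. -/
def packC (σ α x h t : Tm) : Tm :=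
  lam star (lam (contC σ.shift (var 0))
    (app2 (app2 (var 0) α.shift.shift x.shift.shift) h.shift.shift t.shift.shift))

/-- `λ α : ⋆. λ x : α. λ h : α → σ. λ t : α → α. b`; in `b` these variables have the indices
`3, 2, 1, 0`. -/
def lamC (σ b : Tm) : Tm :=
  lam star (lam (var 0) (lam (arr (var 1) σ.shift.shift) (lam (arr (var 2) (var 2)) b)))

/-- `hd s := s σ (λ α x h t. h x)`. -/
def hdC (σ s : Tm) : Tm := app2 s σ (lamC σ (app (var 1) (var 2)))

/-- `tl s := s Stream (λ α x h t. pack α ⟨t x, h, t⟩)`. -/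
def tlC (σ s : Tm) : Tm :=
  app2 s (streamC σ)
    (lamC σ (packC σ.shift.shift.shift.shift (var 3) (app (var 0) (var 2)) (var 1) (var 0)))

/-! ### Bisimilarity and coinduction, for both forms of the stream type -/

/-- The two ways to write out `∃ α : ⋆. α × (α → σ) × (α → α)`: with the definable product type,
or with the existential elimination curried. -/
inductive Form : Type
  | paired : Form
  | curried : Form

/-- The type of streams over `σ`. -/
def Stream : Form → Tm → Tm
  | .paired => streamP
  | .curried => streamC

/-- `pack α ⟨x, h, t⟩`, a stream over `σ`; the arguments are `σ α x h t`. -/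
def packStream : Form → Tm → Tm → Tm → Tm → Tm → Tm
  | .paired => packP
  | .curried => packC

/-- The head of a stream over `σ`; the arguments are `σ s`. -/
def hd : Form → Tm → Tm → Tm
  | .paired => hdP
  | .curried => hdC

/-- The tail of a stream over `σ`; the arguments are `σ s`. -/
def tl : Form → Tm → Tm → Tm
  | .paired => tlP
  | .curried => tlC

/-- `R` is symmetric: `Π x y : Stream. R x y → R y x`. -/
def isSymm (e : Form) (σ R : Tm) : Tm :=
  pi (Stream e σ) (pi (Stream e σ).shift
    (arr (app2 R.shift.shift (var 1) (var 0)) (app2 R.shift.shift (var 0) (var 1))))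

/-- `Π x y : Stream. R x y → hd x = hd y ∧ R (tl x) (tl y)`. -/
def isStable (e : Form) (σ R : Tm) : Tm :=
  pi (Stream e σ) (pi (Stream e σ).shift
    (arr (app2 R.shift.shift (var 1) (var 0))
      (prod
        (leib σ.shift.shift (hd e σ.shift.shift (var 1)) (hd e σ.shift.shift (var 0)))
        (app2 R.shift.shift (tl e σ.shift.shift (var 1)) (tl e σ.shift.shift (var 0))))))

/-- `R` is a bisimulation. -/
def isBisim (e : Form) (σ R : Tm) : Tm := prod (isSymm e σ R) (isStable e σ R)

/-- `s ∼ t := ∃ R : Stream → Stream → ⋆. R is a bisimulation ∧ R s t`. -/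
def bisimilar (e : Form) (σ s t : Tm) : Tm :=
  ex (arr (Stream e σ) (arr (Stream e σ) star))
    (prod (isBisim e σ.shift (var 0)) (app2 (var 0) s.shift t.shift))

/-- The coinduction principle `Π s t : Stream. s ∼ t → s = t` for streams over `σ`. -/
def coind (e : Form) (σ : Tm) : Tm :=
  pi (Stream e σ) (pi (Stream e σ).shift
    (arr (bisimilar e σ.shift.shift (var 1) (var 0))
      (leib (Stream e σ).shift.shift (var 1) (var 0))))

/-- `s₁ := pack bool ⟨true, ¬, ¬⟩`, a stream over `bool`. -/
def s₁ (e : Form) : Tm := packStream e bool bool tt neg neg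

/-- `s₂ := pack bool ⟨false, I, ¬⟩`, a stream over `bool`. -/
def s₂ (e : Form) : Tm := packStream e bool bool ff idBool neg

end LP2

namespace LP2

open Tm

namespace Tm

/-! ### Renaming and substitution -/

/-! The negative half uses a model in which Leibniz equality of closed terms is as fine as
`β`-equality. An object is a pseudo-term modulo `β`, a type is an arbitrary set of objects (so
impredicativity is harmless), and a constructor is a family of such sets indexed by lists of
objects; lists suffice because, without products from kinds to kinds, constructors take only objects
as arguments. Typing is sound for this model (`Typing.sound`). Applying an inhabitant of `t = q` to
the predicate that is full at `t` and empty elsewhere forces `t` and `q` to be `β`-equal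
(`betaEq_of_isInhabited_leib`). But `s₁` and `s₂` are distinct normal forms, which Church–Rosser
keeps apart.

The delicate rule is conversion. The interpretation respects `β` only on terms shaped like
constructors or kinds, and the terms inside a chain of `β`-equalities may lack such a shape. The
shape `Cat` survives reduction, so the values are compared at a common reduct (`Cat.interp_betaEq`);
subject reduction is not needed.

For bisimilarity, put `t₁ = pack bool ⟨false, ¬, ¬⟩` and `t₂ = pack bool ⟨true, I, ¬⟩`. Up to `β`,
`tl` exchanges `sᵢ` and `tᵢ`, both `sᵢ` have head `false` and both `tᵢ` have head `true`. Hence the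
relation consisting of `(s₁, s₂)`, `(t₁, t₂)` and their converses, defined impredicatively, is a
bisimulation. A type inference algorithm proved sound (`inferred_of_infer`) checks the proof terms
by kernel computation; named constants keep these terms small. A coinduction principle would turn
this bisimilarity into the refuted equality. -/

theorem upRen_comp (r q : ℕ → ℕ) : upRen r ∘ upRen q = upRen (r ∘ q) := by
  funext n; cases n <;> rfl

theorem rename_rename (t : Tm) (r q : ℕ → ℕ) : rename r (rename q t) = rename (r ∘ q) t := by
  induction t generalizing r q with
  | sort | var => rfl
  | pi U T hU hT => simp only [rename, hU, hT, upRen_comp]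
  | lam U b hU hb => simp only [rename, hU, hb, upRen_comp]
  | app f a hf ha => simp only [rename, hf, ha]

theorem upSub_comp_upRen (s : ℕ → Tm) (r : ℕ → ℕ) : upSub s ∘ upRen r = upSub (s ∘ r) := by
  funext n; cases n <;> rfl

theorem subst_rename (t : Tm) (s : ℕ → Tm) (r : ℕ → ℕ) : subst s (rename r t) = subst (s ∘ r) t := by
  induction t generalizing s r with
  | sort | var => rfl
  | pi U T hU hT => simp only [rename, subst, hU, hT, upSub_comp_upRen]
  | lam U b hU hb => simp only [rename, subst, hU, hb, upSub_comp_upRen]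
  | app f a hf ha => simp only [rename, subst, hf, ha]

theorem rename_comp_upSub (r : ℕ → ℕ) (s : ℕ → Tm) :
    rename (upRen r) ∘ upSub s = upSub (rename r ∘ s) := by
  funext n
  cases n with
  | zero => rfl
  | succ n => simp only [Function.comp, upSub, shift, rename_rename]; rfl

theorem rename_subst (t : Tm) (r : ℕ → ℕ) (s : ℕ → Tm) :
    rename r (subst s t) = subst (rename r ∘ s) t := by
  induction t generalizing s r with
  | sort | var => rfl
  | pi U T hU hT => simp only [rename, subst, hU, hT, rename_comp_upSub]
  | lam U b hU hb => simp only [rename, subst, hU, hb, rename_comp_upSub]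
  | app f a hf ha => simp only [rename, subst, hf, ha]

theorem shift_subst (t : Tm) (s : ℕ → Tm) : (subst s t).shift = subst (upSub s) t.shift := by
  simp only [shift, rename_subst, subst_rename]; rfl

theorem subst_comp_upSub (s q : ℕ → Tm) : subst (upSub s) ∘ upSub q = upSub (subst s ∘ q) := by
  funext n
  cases n with
  | zero => rfl
  | succ n => simp only [Function.comp, upSub, ← shift_subst]

theorem subst_subst (t : Tm) (s q : ℕ → Tm) : subst s (subst q t) = subst (subst s ∘ q) t := by
  induction t generalizing s q with
  | sort | var => rfl
  | pi U T hU hT => simp only [subst, hU, hT, subst_comp_upSub]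
  | lam U b hU hb => simp only [subst, hU, hb, subst_comp_upSub]
  | app f a hf ha => simp only [subst, hf, ha]

theorem upSub_var : upSub var = var := by
  funext n; cases n <;> rfl

theorem subst_var (t : Tm) : subst var t = t := by
  induction t with
  | sort | var => rfl
  | pi U T hU hT => simp only [subst, hU, hT, upSub_var]
  | lam U b hU hb => simp only [subst, hU, hb, upSub_var]
  | app f a hf ha => simp only [subst, hf, ha]

theorem rename_eq_subst (t : Tm) (r : ℕ → ℕ) : rename r t = subst (var ∘ r) t := by
  rw [← subst_rename, subst_var]

theorem subst_inst (t a : Tm) (s : ℕ → Tm) :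
    subst s (t.inst a) = (subst (upSub s) t).inst (subst s a) := by
  simp only [inst, subst_subst]
  congr 1
  funext n
  cases n with
  | zero => rfl
  | succ n => simp only [Function.comp, single, upSub, shift, subst_rename]; exact (subst_var _).symm

theorem rename_inst (t a : Tm) (r : ℕ → ℕ) :
    rename r (t.inst a) = (rename (upRen r) t).inst (rename r a) := by
  simp only [inst, rename_subst, subst_rename]
  congr 1
  funext n; cases n <;> rfl

end Tm

/-! ### Confluence -/

/-- Parallel reduction. -/
inductive Par : Tm → Tm → Prop
  | sort (s : Srt) : Par (sort s) (sort s)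
  | var (n : ℕ) : Par (var n) (var n)
  | pi {U U' T T' : Tm} : Par U U' → Par T T' → Par (pi U T) (pi U' T')
  | lam {U U' b b' : Tm} : Par U U' → Par b b' → Par (lam U b) (lam U' b')
  | app {f f' a a' : Tm} : Par f f' → Par a a' → Par (app f a) (app f' a')
  | beta (U : Tm) {b b' a a' : Tm} : Par b b' → Par a a' → Par (app (lam U b) a) (b'.inst a')

theorem Par.refl (t : Tm) : Par t t := by
  induction t with
  | sort s => exact .sort s
  | var n => exact .var n
  | pi U T hU hT => exact .pi hU hT
  | lam U b hU hb => exact .lam hU hb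
  | app f a hf ha => exact .app hf ha

theorem Par.rename {t t' : Tm} (h : Par t t') (r : ℕ → ℕ) : Par (t.rename r) (t'.rename r) := by
  induction h generalizing r with
  | sort s => exact .sort s
  | var n => exact .var _
  | pi _ _ hU hT => exact .pi (hU r) (hT _)
  | lam _ _ hU hb => exact .lam (hU r) (hb _)
  | app _ _ hf ha => exact .app (hf r) (ha r)
  | beta U _ _ hb ha => rw [rename_inst]; exact .beta _ (hb _) (ha r)

theorem Par.upSub {s s' : ℕ → Tm} (h : ∀ n, Par (s n) (s' n)) (n : ℕ) :
    Par (Tm.upSub s n) (Tm.upSub s' n) := by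
  cases n with
  | zero => exact .var 0
  | succ n => exact (h n).rename _

theorem Par.subst {t t' : Tm} (h : Par t t') {s s' : ℕ → Tm} (hs : ∀ n, Par (s n) (s' n)) :
    Par (t.subst s) (t'.subst s') := by
  induction h generalizing s s' with
  | sort c => exact .sort c
  | var n => exact hs n
  | pi _ _ hU hT => exact .pi (hU hs) (hT (upSub hs))
  | lam _ _ hU hb => exact .lam (hU hs) (hb (upSub hs))
  | app _ _ hf ha => exact .app (hf hs) (ha hs)
  | beta U _ _ hb ha => rw [subst_inst]; exact .beta _ (hb (upSub hs)) (ha hs)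

theorem Par.inst {t t' a a' : Tm} (h : Par t t') (ha : Par a a') : Par (t.inst a) (t'.inst a') :=
  h.subst fun n => by
    cases n with
    | zero => exact ha
    | succ n => exact .var n

/-- The complete development of a pseudo-term: all its redexes are contracted. -/
def develop : Tm → Tm
  | sort s => sort s
  | var n => var n
  | pi U T => pi (develop U) (develop T)
  | lam U b => lam (develop U) (develop b)
  | app (lam _ b) a => (develop b).inst (develop a)
  | app f a => app (develop f) (develop a)

/-- Takahashi's triangle property: whatever redexes a parallel step leaves standing can be
contracted in one further parallel step, ending at a term that depends on the source alone. The
diamond property follows at once. -/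
theorem Par.develop {t u : Tm} (h : Par t u) : Par u (develop t) := by
  induction h with
  | sort s => exact .sort s
  | var n => exact .var n
  | pi _ _ hU hT => exact .pi hU hT
  | lam _ _ hU hb => exact .lam hU hb
  | beta U _ _ hb ha => exact hb.inst ha
  | @app f f' a a' hf _ ihf iha =>
    cases f with
    | lam U b =>
      cases hf with
      | lam _ _ =>
        cases ihf with
        | lam _ hb => exact .beta _ hb iha
    | sort | var | pi | app => exact .app ihf iha

theorem Step.par {t u : Tm} (h : Step t u) : Par t u := by
  induction h with
  | beta U b a => exact .beta U (.refl b) (.refl a)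
  | piDom T _ h => exact .pi h (.refl T)
  | piCod U _ h => exact .pi (.refl U) h
  | lamDom b _ h => exact .lam h (.refl b)
  | lamBody U _ h => exact .lam (.refl U) h
  | appFun a _ h => exact .app h (.refl a)
  | appArg f _ h => exact .app (.refl f) h

/-- Many-step reduction. -/
abbrev Red : Tm → Tm → Prop := Relation.ReflTransGen Step

theorem Red.pi {U U' T T' : Tm} (hU : Red U U') (hT : Red T T') : Red (pi U T) (pi U' T') :=
  (hU.lift (Tm.pi · T) fun _ _ => .piDom T).trans (hT.lift (Tm.pi U' ·) fun _ _ => .piCod U')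

theorem Red.lam {U U' T T' : Tm} (hU : Red U U') (hT : Red T T') : Red (lam U T) (lam U' T') :=
  (hU.lift (Tm.lam · T) fun _ _ => .lamDom T).trans (hT.lift (Tm.lam U' ·) fun _ _ => .lamBody U')

theorem Red.app {U U' T T' : Tm} (hU : Red U U') (hT : Red T T') : Red (app U T) (app U' T') :=
  (hU.lift (Tm.app · T) fun _ _ => .appFun T).trans (hT.lift (Tm.app U' ·) fun _ _ => .appArg U')

theorem Par.red {t u : Tm} (h : Par t u) : Red t u := by
  induction h with
  | sort | var => exact .refl
  | pi _ _ hU hT => exact hU.pi hT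
  | lam _ _ hU hb => exact hU.lam hb
  | app _ _ hf ha => exact hf.app ha
  | beta U _ _ hb ha => exact ((Red.lam .refl hb).app ha).tail (.beta _ _ _)

theorem red_iff_par {t u : Tm} : Red t u ↔ Relation.ReflTransGen Par t u := by
  constructor
  · intro h
    induction h with
    | refl => exact .refl
    | tail _ h ih => exact ih.tail h.par
  · intro h
    induction h with
    | refl => exact .refl
    | tail _ h ih => exact ih.trans h.red

/-- **Church–Rosser** for pseudo-terms. -/
theorem BetaEq.join {t u : Tm} (h : BetaEq t u) : ∃ v, Red t v ∧ Red u v := by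
  have hcr {a b c : Tm} (hb : Red a b) (hc : Red a c) : ∃ d, Red b d ∧ Red c d := by
    simp only [red_iff_par] at hb hc ⊢
    exact Relation.church_rosser
      (fun a b c hb hc => ⟨develop a, .single hb.develop, .single hc.develop⟩) hb hc
  induction h with
  | rel t u h => exact ⟨u, .single h, .refl⟩
  | refl t => exact ⟨t, .refl, .refl⟩
  | symm t u _ ih => obtain ⟨v, h, h'⟩ := ih; exact ⟨v, h', h⟩
  | trans t u w _ _ ih ih' =>
    obtain ⟨v, h₁, h₂⟩ := ih
    obtain ⟨v', h₃, h₄⟩ := ih'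
    obtain ⟨d, h₅, h₆⟩ := hcr h₂ h₃
    exact ⟨d, h₁.trans h₅, h₄.trans h₆⟩

theorem Red.betaEq {t u : Tm} (h : Red t u) : BetaEq t u := by
  induction h with
  | refl => exact .refl _
  | tail _ h ih => exact .trans _ _ _ ih (.rel _ _ h)

theorem BetaEq.of_join {t u v : Tm} (h : Red t v) (h' : Red u v) : BetaEq t u :=
  .trans _ _ _ h.betaEq (.symm _ _ h'.betaEq)

theorem Red.rename {t u : Tm} (h : Red t u) (r : ℕ → ℕ) : Red (t.rename r) (u.rename r) := by
  induction h with
  | refl => exact .refl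
  | tail _ h ih => exact ih.trans (h.par.rename r).red

theorem BetaEq.upSub {s s' : ℕ → Tm} (h : ∀ n, BetaEq (s n) (s' n)) (n : ℕ) :
    BetaEq (Tm.upSub s n) (Tm.upSub s' n) := by
  cases n with
  | zero => exact .refl _
  | succ n =>
    obtain ⟨v, h₁, h₂⟩ := (h n).join
    exact .of_join (h₁.rename _) (h₂.rename _)

/-- Objects enter terms through chosen representatives, which are determined only up to
`β`-equality; this makes the choice immaterial. -/
theorem BetaEq.subst (t : Tm) {s s' : ℕ → Tm} (h : ∀ n, BetaEq (s n) (s' n)) :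
    BetaEq (t.subst s) (t.subst s') := by
  induction t generalizing s s' with
  | sort => exact .refl _
  | var n => exact h n
  | pi U T hU hT =>
    obtain ⟨_, h₁, h₂⟩ := (hU h).join
    obtain ⟨_, h₃, h₄⟩ := (hT (upSub h)).join
    exact .of_join (h₁.pi h₃) (h₂.pi h₄)
  | lam U b hU hb =>
    obtain ⟨_, h₁, h₂⟩ := (hU h).join
    obtain ⟨_, h₃, h₄⟩ := (hb (upSub h)).join
    exact .of_join (h₁.lam h₃) (h₂.lam h₄)
  | app f a hf ha =>
    obtain ⟨_, h₁, h₂⟩ := (hf h).join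
    obtain ⟨_, h₃, h₄⟩ := (ha h).join
    exact .of_join (h₁.app h₃) (h₂.app h₄)

/-! ### The model

Objects are interpreted as pseudo-terms up to `β`-equality, types as arbitrary sets of objects, and
constructors as families of sets of objects indexed by the list of their arguments. -/

/-- Pseudo-terms up to `β`-equality. -/
abbrev Obj : Type := Quot Step

theorem Obj.mk_eq_mk {t u : Tm} : (Quot.mk Step t : Obj) = Quot.mk Step u ↔ BetaEq t u :=
  ⟨Quot.eqvGen_exact, Quot.eqvGen_sound⟩

/-- Application of objects. -/
def Obj.app : Obj → Obj → Obj :=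
  Quot.map₂ Tm.app (fun f _ _ => .appArg f) (fun _ _ a => .appFun a)

/-- Families of sets of objects indexed by lists of arguments. -/
abbrev Fam : Type := List Obj → Set Obj

/-- `extend d ρ` is `d, ρ 0, ρ 1, …`. -/
def extend {α : Type*} (d : α) (ρ : ℕ → α) : ℕ → α
  | 0 => d
  | n + 1 => ρ n

/-- Valuations of variables, both as objects and as constructors. -/
abbrev Valuation : Type := ℕ → Obj × Fam

/-- The value of a pseudo-term read as an object. -/
noncomputable def eval (ρ : Valuation) (t : Tm) : Obj := Quot.mk Step (t.subst fun n => (ρ n).1.out)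

theorem mk_out (a : Obj) : Quot.mk Step a.out = a := Quot.out_eq a

theorem eval_var (ρ : Valuation) (n : ℕ) : eval ρ (var n) = (ρ n).1 := mk_out _

theorem eval_congr {ρ ρ' : Valuation} (h : ∀ n, (ρ n).1 = (ρ' n).1) (t : Tm) :
    eval ρ t = eval ρ' t := by
  simp only [eval, h]

theorem eval_rename (ρ : Valuation) (t : Tm) (r : ℕ → ℕ) :
    eval ρ (t.rename r) = eval (fun n => ρ (r n)) t := by
  simp only [eval, subst_rename]; rfl

/-- The families `φ` are arbitrary because the reading as an object ignores them. -/
theorem eval_subst (ρ : Valuation) (t : Tm) (s : ℕ → Tm) (φ : ℕ → Fam) :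
    eval ρ (t.subst s) = eval (fun n => (eval ρ (s n), φ n)) t := by
  simp only [eval, subst_subst, Obj.mk_eq_mk]
  exact BetaEq.subst t fun n => Obj.mk_eq_mk.1 (mk_out _).symm

/-- The `β`-rule of the model, which is what soundness of abstraction rests on. -/
theorem eval_lam_app (ρ : Valuation) (U b : Tm) (d : Obj × Fam) :
    (eval ρ (lam U b)).app d.1 = eval (extend d ρ) b := by
  conv_lhs => rw [← mk_out d.1]
  refine (Quot.sound (.beta _ _ _)).trans ?_
  simp only [eval, inst, subst_subst]
  congr 2
  funext n
  cases n with
  | zero => rfl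
  | succ n => simp only [Function.comp, upSub, shift, subst_rename]; exact subst_var _

theorem eval_eq_of_step {t u : Tm} (h : Step t u) (ρ : Valuation) : eval ρ t = eval ρ u :=
  Obj.mk_eq_mk.2 (h.par.subst fun _ => .refl _).red.betaEq

/-- The value of a pseudo-term read as a constructor or a kind.  Kinds denote the set of all
objects. -/
noncomputable def interp : Valuation → Tm → Fam
  | _, sort _ => fun _ => Set.univ
  | ρ, var n => (ρ n).2
  | ρ, pi U T => fun _ =>
      -- The family `d.2` is unrestricted: over a kind this is the quantification over all
      -- constructors, and over a type a well-shaped codomain does not depend on it.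
      {f | ∀ d : Obj × Fam, d.1 ∈ interp ρ U [] → f.app d.1 ∈ interp (extend d ρ) T []}
  | ρ, lam _ b => fun l =>
      -- Constructors abstract over objects only, so the family given to the bound variable is a
      -- filler, as is the value at the empty list.
      match l with
      | [] => ∅
      | a :: l => interp (extend (a, fun _ => ∅) ρ) b l
  | ρ, app f a => fun l => interp ρ f (eval ρ a :: l)

theorem interp_rename (ρ : Valuation) (t : Tm) (r : ℕ → ℕ) :
    interp ρ (t.rename r) = interp (fun n => ρ (r n)) t := by
  have hext (d : Obj × Fam) (ρ : Valuation) (r : ℕ → ℕ) :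
      (fun n => extend d ρ (upRen r n)) = extend d fun n => ρ (r n) := by
    funext n; cases n <;> rfl
  induction t generalizing ρ r with
  | sort | var => rfl
  | pi U T hU hT => simp only [Tm.rename, interp, hU, hT, hext]
  | lam U b hU hb => funext l; cases l <;> simp only [Tm.rename, interp, hb, hext]
  | app f a hf ha => simp only [Tm.rename, interp, hf, eval_rename]

theorem extend_eval_interp (ρ : Valuation) (s : ℕ → Tm) (d : Obj × Fam) :
    (fun n => (eval (extend d ρ) (upSub s n), interp (extend d ρ) (upSub s n))) =
      extend d fun n => (eval ρ (s n), interp ρ (s n)) := by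
  funext n
  cases n with
  | zero => exact Prod.ext (eval_var _ _) rfl
  | succ n => exact Prod.ext (eval_rename _ _ _) (interp_rename _ _ _)

/-- No typing or shape is required, since a valuation records both readings of every variable. -/
theorem interp_subst (ρ : Valuation) (t : Tm) (s : ℕ → Tm) :
    interp ρ (t.subst s) = interp (fun n => (eval ρ (s n), interp ρ (s n))) t := by
  induction t generalizing ρ s with
  | sort | var => rfl
  | pi U T hU hT => simp only [Tm.subst, interp, hU, hT, extend_eval_interp]
  | lam U b hU hb => funext l; cases l <;> simp only [Tm.subst, interp, hb, extend_eval_interp]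
  | app f a hf ha =>
    simp only [Tm.subst, interp, hf, eval_subst ρ a s fun n => interp ρ (s n)]

theorem interp_inst (ρ : Valuation) (t a : Tm) :
    interp ρ (t.inst a) = interp (extend (eval ρ a, interp ρ a) ρ) t := by
  rw [inst, interp_subst]
  congr 1
  funext n
  cases n with
  | zero => rfl
  | succ n => exact Prod.ext (eval_var _ _) rfl

/-! ### Constructors and kinds -/

/-- `Cat .star m t`: `t` has the shape of a constructor, where `m` marks the constructor variables.
`Cat .kind m t`: `t` has the shape of a kind. -/
def Cat : Srt → (ℕ → Prop) → Tm → Prop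
  | c, _, sort s => c = .kind ∧ s = .star
  | c, m, var n => c = .star ∧ m n
  | c, m, pi U T => (Cat .star m U ∧ Cat c (extend False m) T) ∨
      (c = .star ∧ Cat .kind m U ∧ Cat .star (extend True m) T)
  | c, m, lam _ b => c = .star ∧ Cat .star (extend False m) b
  | c, m, app f _ => c = .star ∧ Cat .star m f

/-- Following codomains, a kind ends in `⋆` and a constructor in a variable, an abstraction or an
application, whatever the marks are. -/
theorem Cat.not_kind {m m' : ℕ → Prop} {t : Tm} (h : Cat .star m t) : ¬ Cat .kind m' t := by
  induction t generalizing m m' with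
  | sort => simp [Cat] at h
  | var | lam | app => simp [Cat]
  | pi U T hU hT =>
    rintro (⟨_, hk⟩ | ⟨hc, _⟩)
    · rcases h with ⟨_, h⟩ | ⟨_, _, h⟩ <;> exact hT h hk
    · cases hc

theorem Cat.rename {c : Srt} {m m' : ℕ → Prop} {t : Tm} (h : Cat c m t) (r : ℕ → ℕ)
    (hr : ∀ n, m n → m' (r n)) : Cat c m' (t.rename r) := by
  have hup {m m' : ℕ → Prop} {r : ℕ → ℕ} (p : Prop) (hr : ∀ n, m n → m' (r n)) (n : ℕ)
      (h : extend p m n) : extend p m' (upRen r n) := by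
    cases n with
    | zero => exact h
    | succ n => exact hr n h
  induction t generalizing c m m' r with
  | sort => exact h
  | var n => exact ⟨h.1, hr n h.2⟩
  | pi U T hU hT =>
    exact h.imp (fun h => ⟨hU h.1 r hr, hT h.2 _ (hup _ hr)⟩)
      fun h => ⟨h.1, hU h.2.1 r hr, hT h.2.2 _ (hup _ hr)⟩
  | lam U b hU hb => exact ⟨h.1, hb h.2 _ (hup _ hr)⟩
  | app f a hf ha => exact ⟨h.1, hf h.2 r hr⟩

theorem Cat.subst {c : Srt} {m m' : ℕ → Prop} {t : Tm} (h : Cat c m t) (s : ℕ → Tm)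
    (hs : ∀ n, m n → Cat .star m' (s n)) : Cat c m' (t.subst s) := by
  have hup {m m' : ℕ → Prop} {s : ℕ → Tm} (p : Prop) (hs : ∀ n, m n → Cat .star m' (s n)) (n : ℕ)
      (h : extend p m n) : Cat .star (extend p m') (upSub s n) := by
    cases n with
    | zero => exact ⟨rfl, h⟩
    | succ n => exact (hs n h).rename _ fun _ h => h
  induction t generalizing c m m' s with
  | sort => exact h
  | var n =>
    obtain ⟨rfl, h⟩ := h
    exact hs n h
  | pi U T hU hT =>
    exact h.imp (fun h => ⟨hU h.1 s hs, hT h.2 _ (hup _ hs)⟩)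
      fun h => ⟨h.1, hU h.2.1 s hs, hT h.2.2 _ (hup _ hs)⟩
  | lam U b hU hb => exact ⟨h.1, hb h.2 _ (hup _ hs)⟩
  | app f a hf ha => exact ⟨h.1, hf h.2 s hs⟩

theorem Cat.inst {c : Srt} {m : ℕ → Prop} {p : Prop} {t a : Tm} (h : Cat c (extend p m) t)
    (ha : p → Cat .star m a) : Cat c m (t.inst a) :=
  h.subst _ fun n hn => by
    cases n with
    | zero => exact ha hn
    | succ n => exact ⟨rfl, hn⟩

/-- This stands in for subject reduction. The variable of a constructor abstraction is unmarked, so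
nothing is required of the argument of a contracted redex. -/
theorem Cat.step {c : Srt} {m : ℕ → Prop} {t u : Tm} (h : Cat c m t) (hs : Step t u) :
    Cat c m u := by
  induction hs generalizing c m with
  | beta U b a =>
    obtain ⟨rfl, -, h⟩ := h
    exact h.inst False.elim
  | piDom T _ ih => exact h.imp (fun h => ⟨ih h.1, h.2⟩) fun h => ⟨h.1, ih h.2.1, h.2.2⟩
  | piCod U _ ih => exact h.imp (fun h => ⟨h.1, ih h.2⟩) fun h => ⟨h.1, h.2.1, ih h.2.2⟩
  | lamDom b _ ih => exact h
  | lamBody U _ ih => exact ⟨h.1, ih h.2⟩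
  | appFun a _ ih => exact ⟨h.1, ih h.2⟩
  | appArg f _ ih => exact h

theorem Cat.red {c : Srt} {m : ℕ → Prop} {t u : Tm} (h : Cat c m t) (hs : Red t u) :
    Cat c m u := by
  induction hs with
  | refl => exact h
  | tail _ hs ih => exact ih.step hs

/-- The value of a constructor or kind depends on the constructor variables and the objects only. -/
theorem Cat.interp_congr {c : Srt} {m : ℕ → Prop} {t : Tm} (h : Cat c m t) {ρ ρ' : Valuation}
    (h₁ : ∀ n, (ρ n).1 = (ρ' n).1) (h₂ : ∀ n, m n → (ρ n).2 = (ρ' n).2) :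
    interp ρ t = interp ρ' t := by
  have hext₁ {ρ ρ' : Valuation} (h : ∀ n, (ρ n).1 = (ρ' n).1) (d : Obj × Fam) (n : ℕ) :
      (extend d ρ n).1 = (extend d ρ' n).1 := by
    cases n with
    | zero => rfl
    | succ n => exact h n
  have hext₂ {m : ℕ → Prop} {ρ ρ' : Valuation} (h : ∀ n, m n → (ρ n).2 = (ρ' n).2) (p : Prop)
      (d : Obj × Fam) (n : ℕ) (hn : extend p m n) : (extend d ρ n).2 = (extend d ρ' n).2 := by
    cases n with
    | zero => rfl
    | succ n => exact h n hn
  induction t generalizing c m ρ ρ' with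
  | sort => rfl
  | var n => exact h₂ n h.2
  | pi U T hU hT =>
    rcases h with ⟨h, h'⟩ | ⟨_, h, h'⟩ <;>
    · simp only [interp, hU h h₁ h₂, fun d => hT h' (hext₁ h₁ d) (hext₂ h₂ _ d)]
  | lam U b hU hb =>
    funext l
    cases l with
    | nil => rfl
    | cons a l => simp only [interp, hb h.2 (hext₁ h₁ _) (hext₂ h₂ _ _)]
  | app f a hf ha => simp only [interp, hf h.2 h₁ h₂, eval_congr h₁]

/-- In a `β`-step the two sides differ only in the family recorded for the bound variable: empty for
the redex, the value of the argument for the contractum. That variable is unmarked, so the body does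
not see the difference. -/
theorem Cat.interp_step {c : Srt} {m : ℕ → Prop} {t u : Tm} (h : Cat c m t) (hs : Step t u)
    (ρ : Valuation) : interp ρ t = interp ρ u := by
  induction hs generalizing c m ρ with
  | beta U b a =>
    rw [interp_inst]
    funext l
    refine congrFun (h.2.2.interp_congr (fun n => ?_) fun n hn => ?_) l
    · cases n <;> rfl
    · cases n with
      | zero => exact hn.elim
      | succ n => rfl
  | piDom T _ ih => rcases h with ⟨h, _⟩ | ⟨_, h, _⟩ <;> simp only [interp, ih h]
  | piCod U _ ih => rcases h with ⟨_, h⟩ | ⟨_, _, h⟩ <;> simp only [interp, ih h]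
  | lamDom b _ ih => rfl
  | lamBody U _ ih => funext l; cases l <;> simp only [interp, ih h.2]
  | appFun a _ ih => simp only [interp, ih h.2]
  | appArg f hs ih => simp only [interp, eval_eq_of_step hs]

theorem Cat.interp_red {c : Srt} {m : ℕ → Prop} {t u : Tm} (h : Cat c m t) (hs : Red t u)
    (ρ : Valuation) : interp ρ t = interp ρ u := by
  induction hs with
  | refl => rfl
  | tail hr hs ih => exact ih.trans ((h.red hr).interp_step hs ρ)

/-- Only the endpoints are known to have a shape, so the comparison goes through a common reduct,
where both shapes persist. -/
theorem Cat.interp_betaEq {c c' : Srt} {m m' : ℕ → Prop} {t u : Tm} (h : Cat c m t)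
    (h' : Cat c' m' u) (hs : BetaEq t u) (ρ : Valuation) : interp ρ t = interp ρ u := by
  obtain ⟨v, ht, hu⟩ := hs.join
  rw [h.interp_red ht, h'.interp_red hu]

theorem Cat.srt_eq {c c' : Srt} {m m' : ℕ → Prop} {t u : Tm} (h : Cat c m t)
    (h' : Cat c' m' u) (hs : BetaEq t u) : c = c' := by
  obtain ⟨v, ht, hu⟩ := hs.join
  have h₁ := h.red ht
  have h₂ := h'.red hu
  cases c <;> cases c' <;> first | rfl | exact absurd h₂ h₁.not_kind | exact absurd h₁ h₂.not_kind

/-- The constructor variables of a context. -/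
def mark : Ctx → ℕ → Prop
  | [] => fun _ => False
  | T :: Γ => extend (Cat .kind (mark Γ) T) (mark Γ)

/-- Either `t` is a kind, or a constructor and `T` a kind, or `T` is a type. -/
def Classified (m : ℕ → Prop) (t T : Tm) : Prop :=
  (T = sort .kind ∧ Cat .kind m t) ∨ (Cat .kind m T ∧ Cat .star m t) ∨ Cat .star m T

theorem Classified.cat_of_sort {m : ℕ → Prop} {t : Tm} {s : Srt} (h : Classified m t (sort s)) :
    Cat s m t := by
  rcases h with ⟨h, h'⟩ | ⟨⟨_, rfl⟩, h⟩ | h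
  · cases h; exact h'
  · exact h
  · simp [Cat] at h

theorem Cat.not_betaEq_kind {c : Srt} {m : ℕ → Prop} {t : Tm} (h : Cat c m t) :
    ¬ BetaEq (sort .kind) t := by
  intro hs
  obtain ⟨v, hk, ht⟩ := hs.join
  have hv : v = sort .kind := by
    clear ht
    induction hk with
    | refl => rfl
    | tail _ h ih => subst ih; cases h
  subst hv
  have := h.red ht
  simp [Cat] at this

theorem mark_of_star {Γ : Ctx} {U : Tm} (h : Cat .star (mark Γ) U) :
    mark (U :: Γ) = extend False (mark Γ) := by
  rw [mark, eq_false h.not_kind]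

theorem mark_of_kind {Γ : Ctx} {U : Tm} (h : Cat .kind (mark Γ) U) :
    mark (U :: Γ) = extend True (mark Γ) := by
  rw [mark, eq_true h]

/-- Stratification into levels, by induction on the derivation. Conversion cannot change the level
because constructors and kinds have no common reducts. -/
theorem Typing.classified {Γ : Ctx} {t T : Tm} (h : Typing Γ t T) : Classified (mark Γ) t T := by
  have hshift {Γ : Ctx} {t T : Tm} {c : Srt} (h : Cat c (mark Γ) t) : Cat c (mark (T :: Γ)) t.shift :=
    h.rename _ fun _ h => h
  induction h with
  | axm => exact .inl ⟨rfl, rfl, rfl⟩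
  | @var Γ T s _ ih =>
    have := ih.cat_of_sort
    cases s with
    | star => exact .inr (.inr (hshift this))
    | kind => exact .inr (.inl ⟨hshift this, rfl, this⟩)
  | weak _ _ ih _ =>
    exact ih.imp (fun h => ⟨by rw [h.1]; rfl, hshift h.2⟩) fun h =>
      h.imp (fun h => ⟨hshift h.1, hshift h.2⟩) hshift
  | conv _ _ hs ih ih' =>
    have hU := ih'.cat_of_sort
    rcases ih with ⟨rfl, h⟩ | ⟨h, h'⟩ | h
    · exact absurd hs hU.not_betaEq_kind
    · cases h.srt_eq hU hs; exact .inr (.inl ⟨hU, h'⟩)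
    · cases h.srt_eq hU hs; exact .inr (.inr hU)
  | @pi Γ U T s₁ s₂ hne _ _ ih ih' =>
    have hU := ih.cat_of_sort
    have hT := ih'.cat_of_sort
    have key : Cat s₂ (mark Γ) (Tm.pi U T) := by
      cases s₁ with
      | star => rw [mark_of_star hU] at hT; exact .inl ⟨hU, hT⟩
      | kind =>
        cases s₂ with
        | star => rw [mark_of_kind hU] at hT; exact .inr ⟨rfl, hU, hT⟩
        | kind => exact absurd rfl hne
    cases s₂ with
    | star => exact .inr (.inl ⟨⟨rfl, rfl⟩, key⟩)
    | kind => exact .inl ⟨rfl, key⟩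
  | @lam Γ U T b s _ _ ih ih' =>
    have hpi := ih.cat_of_sort
    cases s with
    | star => exact .inr (.inr hpi)
    | kind =>
      refine .inr (.inl ⟨hpi, rfl, ?_⟩)
      rcases hpi with ⟨hU, hT⟩ | ⟨h, _⟩
      · rw [mark_of_star hU] at ih'
        rcases ih' with ⟨rfl, h⟩ | ⟨_, h⟩ | h
        · simp [Cat] at hT
        · exact h
        · exact absurd hT h.not_kind
      · cases h
  | @app Γ f a U T _ _ ih ih' =>
    rcases ih with ⟨h, _⟩ | ⟨h, h'⟩ | h
    · cases h
    · rcases h with ⟨_, h⟩ | ⟨h, _⟩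
      · exact .inr (.inl ⟨h.inst False.elim, rfl, h'⟩)
      · cases h
    · refine .inr (.inr ?_)
      rcases h with ⟨_, h⟩ | ⟨_, hU, h⟩
      · exact h.inst False.elim
      -- The domain is a kind, so the variable is marked and the argument must itself be a
      -- constructor.
      · refine h.inst fun _ => ?_
        rcases ih' with ⟨rfl, _⟩ | ⟨_, h⟩ | h
        · simp [Cat] at hU
        · exact h
        · exact absurd hU h.not_kind

/-! ### Soundness -/

/-- The valuation `ρ` assigns to each variable of the context an object of its type. -/
def Models : Valuation → Ctx → Prop
  | _, [] => True
  | ρ, T :: Γ => (ρ 0).1 ∈ interp (fun n => ρ (n + 1)) T [] ∧ Models (fun n => ρ (n + 1)) Γ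

/-- Products are interpreted so that abstraction and application hold by definition together with
the substitution lemmas. Only conversion consults the shapes. -/
theorem Typing.sound {Γ : Ctx} {t T : Tm} (h : Typing Γ t T) {ρ : Valuation} (hρ : Models ρ Γ) :
    eval ρ t ∈ interp ρ T [] := by
  induction h generalizing ρ with
  | axm => trivial
  | var _ _ => rw [eval_var, shift, interp_rename]; exact hρ.1
  | weak _ _ ih _ => rw [shift, shift, interp_rename, eval_rename]; exact ih hρ.2
  | conv h h' hs ih _ =>
    have hU := h'.classified.cat_of_sort
    rcases h.classified with ⟨rfl, _⟩ | ⟨hT, _⟩ | hT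
    · exact absurd hs hU.not_betaEq_kind
    all_goals rw [← hT.interp_betaEq hU hs]; exact ih hρ
  | pi => trivial
  | lam _ _ _ ih =>
    intro d hd
    rw [eval_lam_app]
    exact ih ⟨hd, hρ⟩
  | @app Γ f a U T _ _ ih ih' =>
    rw [interp_inst]
    exact ih hρ (eval ρ a, interp ρ a) (ih' hρ)

/-- Leibniz equality of closed terms is inhabited only if they are `β`-equal. -/
theorem betaEq_of_isInhabited_leib {σ t q : Tm} (ht : ∀ s, t.subst s = t) (hq : ∀ s, q.subst s = q)
    (h : IsInhabited (leib σ t q)) : BetaEq t q := by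
  obtain ⟨M, hM⟩ := h
  by_contra hne
  have heval (ρ : Valuation) {u : Tm} (hu : ∀ s, u.subst s = u) : eval ρ u = Quot.mk Step u :=
    congrArg _ (hu _)
  -- The chosen predicate contains every object at the argument `t` and none at any other. Kinds
  -- contain all objects, so any object can accompany it, and any object serves as the proof of `P
  -- t`.
  have := hM.sound (ρ := fun _ => (Quot.mk Step t, fun _ => ∅)) trivial
    (Quot.mk Step t, fun l => {_a | l = [Quot.mk Step t]}) (fun _ _ => trivial)
    (Quot.mk Step t, fun _ => ∅)
  simp only [interp, shift, Tm.rename, rename_eq_subst, ht, hq] at this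
  have : [eval _ q] = [Quot.mk Step t] := this (congrArg (fun a => [a]) (heval _ ht))
  rw [heval _ hq] at this
  exact hne (.symm _ _ (Obj.mk_eq_mk.1 (List.singleton_inj.1 this)))

/-! ### Type inference -/

/-- Boolean equality of pseudo-terms. -/
def Tm.beq : Tm → Tm → Bool
  | sort .star, sort .star => true
  | sort .kind, sort .kind => true
  | var m, var n => Nat.beq m n
  | pi U T, pi U' T' => beq U U' && beq T T'
  | lam U b, lam U' b' => beq U U' && beq b b'
  | app f a, app f' a' => beq f f' && beq a a'
  | _, _ => false

theorem Tm.eq_of_beq {t u : Tm} (h : t.beq u = true) : t = u := by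
  induction t generalizing u with
  | sort s => cases s <;> rcases u with (_ | _) | _ | _ | _ | _ <;> simp_all [Tm.beq]
  | var n => rcases u with (_ | _) | _ | _ | _ | _ <;> simp_all [Tm.beq]
  | pi U T hU hT | lam U T hU hT | app U T hU hT =>
    rcases u with (_ | _) | _ | _ | _ | _ <;> simp_all [Tm.beq]
    exact ⟨hU h.1, hT h.2⟩

/-! Terms may refer to defined constants: in a context of length `m`, the variable `m + i` stands for
the `i`-th constant. -/

/-- The definition and the type of a constant, in terms of the preceding constants. -/
structure Decl where
  body : Tm
  type : Tm

/-- The constants in use. -/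
abbrev Sig : Type := List Decl

/-- The substitution of the closed terms in a list for the constants. -/
def lookup (l : List Tm) (i : ℕ) : Tm := l.getD i (sort .star)

/-- Append the values of the constants in a list of declarations to a list of values. -/
def appendValues : List Tm → Sig → List Tm
  | l, [] => l
  | l, d :: S => appendValues (l ++ [d.body.subst (lookup l)]) S

/-- The values of the constants. -/
def Sig.val (S : Sig) : ℕ → Tm := lookup (appendValues [] S)

/-- All the free variables of the term are among the first `k`. -/
def Tm.closedAt : ℕ → Tm → Bool
  | _, sort _ => true
  | k, var n => n < k
  | k, pi U T => closedAt k U && closedAt (k + 1) T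
  | k, lam U b => closedAt k U && closedAt (k + 1) b
  | k, app f a => closedAt k f && closedAt k a

theorem Tm.subst_eq_of_closedAt {k : ℕ} {t : Tm} (h : t.closedAt k = true) {s s' : ℕ → Tm}
    (hs : ∀ n < k, s n = s' n) : t.subst s = t.subst s' := by
  have hup {k : ℕ} {s s' : ℕ → Tm} (hs : ∀ n < k, s n = s' n) (n : ℕ) (hn : n < k + 1) :
      upSub s n = upSub s' n := by
    cases n with
    | zero => rfl
    | succ n => exact congrArg shift (hs n (Nat.lt_of_succ_lt_succ hn))
  induction t generalizing k s s' with
  | sort => rfl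
  | var n => exact hs n (of_decide_eq_true h)
  | pi U T hU hT | lam U T hU hT =>
    obtain ⟨h, h'⟩ := (Bool.and_eq_true _ _).mp h
    simp only [subst, hU h hs, hT h' (hup hs)]
  | app f a hf ha =>
    obtain ⟨h, h'⟩ := (Bool.and_eq_true _ _).mp h
    simp only [subst, hf h hs, ha h' hs]

/-- The substitution `s` under `m` binders. -/
def liftSub (s : ℕ → Tm) : ℕ → ℕ → Tm
  | 0 => s
  | m + 1 => upSub (liftSub s m)

theorem liftSub_add (s : ℕ → Tm) (m n : ℕ) : liftSub s m (n + m) = rename (· + m) (s n) := by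
  induction m with
  | zero => rw [rename_eq_subst]; exact (subst_var _).symm
  | succ m ih => rw [liftSub, ← add_assoc, upSub, ih, shift, rename_rename]; rfl

/-- Replace the constants in a term by their values. -/
def Sig.expand (S : Sig) (m : ℕ) (t : Tm) : Tm := t.subst (liftSub S.val m)

theorem Sig.expand_shift (S : Sig) (m : ℕ) (t : Tm) :
    S.expand (m + 1) t.shift = (S.expand m t).shift :=
  (shift_subst _ _).symm

theorem Sig.expand_inst (S : Sig) (m : ℕ) (t a : Tm) :
    S.expand m (t.inst a) = (S.expand (m + 1) t).inst (S.expand m a) :=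
  subst_inst _ _ _

theorem Sig.expand_lift (S : Sig) (m : ℕ) (t : Tm) :
    S.expand m (rename (· + m) t) = rename (· + m) (S.expand 0 t) := by
  simp only [expand, subst_rename, rename_subst]
  congr 1
  exact funext (liftSub_add _ m)

/-- The definitions of the constants agree with their values. -/
def Sig.Coherent (S : Sig) : Prop :=
  ∀ i, ∀ d, S[i]? = some d → S.expand 0 d.body = S.val i

theorem lookup_appendValues (l : List Tm) (S : Sig) {n : ℕ} (hn : n < l.length) :
    lookup (appendValues l S) n = lookup l n := by
  induction S generalizing l with
  | nil => rfl
  | cons d S ih =>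
    rw [appendValues, ih _ (by simp; omega), lookup, lookup, List.getD_append _ _ _ _ hn]

/-- A signature is coherent if each definition refers to preceding constants only. -/
theorem Sig.coherent_of_closedAt {S : Sig} (h : S.zipIdx.all (fun p => p.1.body.closedAt p.2) = true) :
    S.Coherent := by
  have key (l : List Tm) (S : Sig) (i : ℕ) (d : Decl) (hd : S[i]? = some d)
      (hs : d.body.closedAt (l.length + i) = true) :
      d.body.subst (lookup (appendValues l S)) = lookup (appendValues l S) (l.length + i) := by
    induction S generalizing l i with
    | nil => cases hd
    | cons c S ih =>
      cases i with
      | zero =>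
        cases hd
        rw [appendValues, lookup_appendValues (n := l.length + 0) _ _ (by simp),
          subst_eq_of_closedAt (s' := lookup l) hs]
        · simp [lookup]
        · intro n hn
          rw [lookup_appendValues _ _ (by simp; omega), lookup, lookup, List.getD_append _ _ _ _ hn]
      | succ i =>
        have := ih (l ++ [c.body.subst (lookup l)]) i hd
          (by rwa [List.length_append, List.length_singleton, add_assoc, add_comm 1])
        rwa [List.length_append, List.length_singleton, add_assoc, add_comm 1] at this
  intro i d hd
  have := key [] S i d hd
  rw [List.length_nil, zero_add] at this
  refine this (List.all_eq_true.1 h (d, i) ?_)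
  exact List.mem_zipIdx_iff_getElem?.2 hd

theorem Sig.Coherent.expand_var {S : Sig} (hS : S.Coherent) {m i : ℕ} {d : Decl}
    (h : S[i]? = some d) : S.expand m (rename (· + m) d.body) = S.expand m (var (i + m)) := by
  rw [expand_lift, hS i d h]
  exact (liftSub_add _ m i).symm

/-! ### Reduction and conversion with constants -/

/-- Contract the head redexes and unfold the constants in head position. -/
def headReduce (S : Sig) : ℕ → ℕ → Tm → Tm
  | k + 1, m, app f a =>
    match headReduce S k m f with
    | lam _ b => headReduce S k m (b.inst a)
    | f' => app f' a
  | k + 1, m, var n =>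
    if n < m then var n else
      match S[n - m]? with
      | some d => headReduce S k m (rename (· + m) d.body)
      | none => var n
  | _, _, t => t

/-- Unfolding a constant becomes an identity after expansion, so only the contracted redexes count
as reduction steps. -/
theorem red_headReduce {S : Sig} (hS : S.Coherent) (k m : ℕ) (t : Tm) :
    Red (S.expand m t) (S.expand m (headReduce S k m t)) := by
  induction k generalizing t with
  | zero => exact .refl
  | succ k ih =>
    cases t with
    | sort | pi | lam => exact .refl
    | var n =>
      rw [headReduce]
      split_ifs with hn
      · exact .refl
      split
      next d hd =>
        have := hS.expand_var (m := m) hd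
        rw [Nat.sub_add_cancel (not_lt.1 hn)] at this
        rw [← this]
        exact ih _
      next => exact .refl
    | app f a =>
      have hf := ih f
      rw [headReduce]
      split
      next _ b heq =>
        rw [heq] at hf
        refine ((hf.app .refl).tail (.beta _ _ _)).trans ?_
        have := ih (b.inst a)
        rwa [S.expand_inst] at this
      next => exact hf.app .refl

/-- Compare the immediate subterms by means of `cmp`. -/
def compareParts (cmp : ℕ → Tm → Tm → Bool) (m : ℕ) : Tm → Tm → Bool
  | pi U T, pi U' T' => cmp m U U' && cmp (m + 1) T T'
  | lam U b, lam U' b' => cmp m U U' && cmp (m + 1) b b'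
  | app f a, app g b => cmp m a b && cmp m f g
  | t, u => t.beq u

theorem betaEq_of_compareParts {S : Sig} {cmp : ℕ → Tm → Tm → Bool}
    (hcmp : ∀ {m t u}, cmp m t u = true → BetaEq (S.expand m t) (S.expand m u)) {m : ℕ} {t u : Tm}
    (h : compareParts cmp m t u = true) : BetaEq (S.expand m t) (S.expand m u) := by
  unfold compareParts at h
  split at h
  · rw [Bool.and_eq_true] at h
    obtain ⟨_, h₁, h₂⟩ := (hcmp h.1).join
    obtain ⟨_, h₃, h₄⟩ := (hcmp h.2).join
    exact .of_join (h₁.pi h₃) (h₂.pi h₄)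
  · rw [Bool.and_eq_true] at h
    obtain ⟨_, h₁, h₂⟩ := (hcmp h.1).join
    obtain ⟨_, h₃, h₄⟩ := (hcmp h.2).join
    exact .of_join (h₁.lam h₃) (h₂.lam h₄)
  · rw [Bool.and_eq_true] at h
    obtain ⟨_, h₁, h₂⟩ := (hcmp h.1).join
    obtain ⟨_, h₃, h₄⟩ := (hcmp h.2).join
    exact .of_join (h₃.app h₁) (h₄.app h₂)
  · rw [eq_of_beq h]; exact .refl _

/-- A test for equality up to `β`-reduction and unfolding of constants. -/
def convertible (S : Sig) : ℕ → ℕ → Tm → Tm → Bool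
  | 0, _, t, u => t.beq u
  | k + 1, m, t, u => compareParts (convertible S k) m t u ||
      compareParts (convertible S k) m (headReduce S k m t) (headReduce S k m u)

theorem betaEq_of_convertible {S : Sig} (hS : S.Coherent) {k m : ℕ} {t u : Tm}
    (h : convertible S k m t u = true) : BetaEq (S.expand m t) (S.expand m u) := by
  induction k generalizing m t u with
  | zero => rw [eq_of_beq h]; exact .refl _
  | succ k ih =>
    rw [convertible, Bool.or_eq_true] at h
    rcases h with h | h
    · exact betaEq_of_compareParts ih h
    · exact .trans _ _ _ (red_headReduce hS k m t).betaEq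
        (.trans _ _ _ (betaEq_of_compareParts ih h) (.symm _ _ (red_headReduce hS k m u).betaEq))

/-! ### Inference and its soundness -/

/-- Well-formed contexts. -/
inductive WellFormed : Ctx → Prop
  | nil : WellFormed []
  | cons {Γ : Ctx} {T : Tm} {s : Srt} :
      WellFormed Γ → Typing Γ T (sort s) → WellFormed (T :: Γ)

theorem WellFormed.weaken {Γ : Ctx} (h : WellFormed Γ) {t T : Tm} (hT : Typing [] t T) :
    Typing Γ (rename (· + Γ.length) t) (rename (· + Γ.length) T) := by
  induction h with
  | nil =>
    have (u : Tm) : rename (fun n => n + ([] : Ctx).length) u = u :=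
      (rename_eq_subst _ _).trans (subst_var u)
    rwa [this, this]
  | cons _ hU ih =>
    have := ih.weak hU
    rw [shift, shift, rename_rename, rename_rename] at this
    exact this

/-- The type of a variable. -/
def varType : Ctx → ℕ → Option Tm
  | [], _ => none
  | T :: _, 0 => some T.shift
  | _ :: Γ, n + 1 => (varType Γ n).map shift

/-- Replace the constants in a context by their values. -/
def Sig.expandCtx (S : Sig) : Ctx → Ctx
  | [] => []
  | T :: Γ => S.expand Γ.length T :: expandCtx S Γ

theorem Sig.length_expandCtx (S : Sig) (Γ : Ctx) : (S.expandCtx Γ).length = Γ.length := by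
  induction Γ with
  | nil => rfl
  | cons T Γ ih => simp only [expandCtx, List.length_cons, ih]

theorem Typing.of_varType {S : Sig} {Γ : Ctx} (h : WellFormed (S.expandCtx Γ)) {n : ℕ} {T : Tm}
    (hn : varType Γ n = some T) :
    Typing (S.expandCtx Γ) (S.expand Γ.length (Tm.var n)) (S.expand Γ.length T) := by
  induction Γ generalizing n T with
  | nil => cases hn
  | cons U Γ ih =>
    obtain _ | ⟨h, hU⟩ := h
    cases n with
    | zero => cases hn; rw [List.length_cons, S.expand_shift]; exact .var hU
    | succ n =>
      obtain ⟨T', hT', rfl⟩ := Option.map_eq_some_iff.1 hn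
      rw [List.length_cons, S.expand_shift]
      exact .weak (ih h hT') hU

/-- The sort that is the given type, if it is one. -/
def asSort : Option Tm → Option Srt
  | some (sort s) => some s
  | _ => none

theorem asSort_eq_some {o : Option Tm} {s : Srt} : asSort o = some s ↔ o = some (sort s) := by
  rcases o with _ | _ | _ | _ | _ | _ <;> simp [asSort]

/-- The sort of a product, given the sorts of its domain and its codomain. -/
def piSort : Option Srt → Option Srt → Option Srt
  | some .kind, some .kind => none
  | some _, some s => some s
  | _, _ => none

theorem Typing.pi_of_piSort {Γ : Ctx} {U T : Tm} {o o' : Option Srt} {s : Srt}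
    (h : piSort o o' = some s) (hU : ∀ s, o = some s → Typing Γ U (sort s))
    (hT : ∀ s₁ s, o = some s₁ → o' = some s → Typing (U :: Γ) T (sort s)) :
    Typing Γ (Tm.pi U T) (sort s) := by
  rcases o with _ | s₁ <;> rcases o' with _ | s₂
  · cases h
  · cases h
  · cases s₁ <;> cases h
  · refine .pi (s₁ := s₁) ?_ (hU _ rfl) (hT _ _ rfl ?_)
    · rintro ⟨⟩; cases s₂ <;> cases h
    · cases s₁ <;> cases s₂ <;> cases h <;> rfl

/-- The given type, if it is a product, and else its head reduct, provided that it is typable. -/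
def exposePi (S : Sig) (k m : ℕ) (sortOf : Tm → Option Srt) : Tm → Option Tm
  | pi U T => some (pi U T)
  | F => (sortOf (headReduce S k m F)).map fun _ => headReduce S k m F

/-- `A` may be replaced by `U` as the type of a term. -/
def coercible (S : Sig) (k m : ℕ) (sortOf : Tm → Option Srt) (A U : Tm) : Bool :=
  A.beq U || ((sortOf U).isSome && convertible S k m A U)

/-- The conversion rule demands a sort for the new type. Without subject reduction this must be
supplied by a fresh inference for the head reduct. -/
theorem Typing.exposePi {S : Sig} (hS : S.Coherent) {k m : ℕ} {sortOf : Tm → Option Srt} {Γ : Ctx}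
    {t F F' : Tm} (h : Typing Γ t (S.expand m F)) (hF : LP2.exposePi S k m sortOf F = some F')
    (hs : ∀ T s, sortOf T = some s → Typing Γ (S.expand m T) (sort s)) :
    Typing Γ t (S.expand m F') := by
  have key (hF : (sortOf (headReduce S k m F)).map (fun _ => headReduce S k m F) = some F') :
      Typing Γ t (S.expand m F') := by
    obtain ⟨s, h', rfl⟩ := Option.map_eq_some_iff.1 hF
    exact h.conv (hs _ _ h') (red_headReduce hS k m F).betaEq
  cases F with
  | pi U T => cases hF; exact h
  | sort | var | lam | app => exact key hF

theorem Typing.coerce {S : Sig} (hS : S.Coherent) {k m : ℕ} {sortOf : Tm → Option Srt} {Γ : Ctx}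
    {t A U : Tm} (h : Typing Γ t (S.expand m A)) (hF : coercible S k m sortOf A U = true)
    (hs : ∀ T s, sortOf T = some s → Typing Γ (S.expand m T) (sort s)) :
    Typing Γ t (S.expand m U) := by
  rw [coercible, Bool.or_eq_true, Bool.and_eq_true, Option.isSome_iff_exists] at hF
  rcases hF with h' | ⟨⟨s, h'⟩, h''⟩
  · rwa [← eq_of_beq h']
  · exact h.conv (hs _ _ h') (betaEq_of_convertible hS h'')

/-- Type inference with bounded recursion depth, where the first `N` constants may be used.
If the sort of the inferred type is known, it is returned too. -/
def infer (S : Sig) (N : ℕ) : ℕ → Ctx → Tm → Option (Tm × Option Srt)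
  | 0, _, _ => none
  | k + 1, Γ, t =>
    let sortOf (Γ : Ctx) (T : Tm) : Option Srt := asSort ((infer S N k Γ T).map Prod.fst)
    match t with
    | sort .star => some (sort .kind, none)
    | sort .kind => none
    | var n =>
      if n < Γ.length then (varType Γ n).map fun T => (T, none)
      else if n - Γ.length < N then
        S[n - Γ.length]?.map fun d => (rename (· + Γ.length) d.type, none)
      else none
    | pi U T => (piSort (sortOf Γ U) (sortOf (U :: Γ) T)).map fun s => (sort s, none)
    | lam U b => do
      let (T, o) ← infer S N k (U :: Γ) b
      let s ← piSort (sortOf Γ U) (o.or (sortOf (U :: Γ) T))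
      some (pi U T, some s)
    | app f a => do
      let F ← infer S N k Γ f
      let A ← infer S N k Γ a
      match exposePi S k Γ.length (sortOf Γ) F.1 with
      | some (pi U T) =>
        if coercible S k Γ.length (sortOf Γ) A.1 U then some (T.inst a, none) else none
      | _ => none

/-- The judgments that the result of `infer` stands for. -/
def Inferred (S : Sig) (Γ : Ctx) (t : Tm) (p : Tm × Option Srt) : Prop :=
  Typing (S.expandCtx Γ) (S.expand Γ.length t) (S.expand Γ.length p.1) ∧
    ∀ s, p.2 = some s → Typing (S.expandCtx Γ) (S.expand Γ.length p.1) (sort s)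

theorem Typing.inferred {S : Sig} {Γ : Ctx} {t T : Tm}
    (h : Typing (S.expandCtx Γ) (S.expand Γ.length t) (S.expand Γ.length T)) :
    Inferred S Γ t (T, none) :=
  ⟨h, fun _ h => nomatch h⟩

/-- The first `N` constants have the types in the signature. -/
def Sig.Valid (S : Sig) (N : ℕ) : Prop :=
  ∀ i < N, ∀ d, S[i]? = some d → Typing [] (S.val i) (S.expand 0 d.type)

/-- Soundness alone is proved: running out of recursion depth yields `none`, about which nothing is
claimed. -/
theorem inferred_of_infer {S : Sig} (hS : S.Coherent) {N : ℕ} (hN : S.Valid N) {k : ℕ} {Γ : Ctx}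
    (hΓ : WellFormed (S.expandCtx Γ)) {t : Tm} {p : Tm × Option Srt}
    (h : infer S N k Γ t = some p) : Inferred S Γ t p := by
  induction k generalizing Γ t p with
  | zero => cases h
  | succ k ih =>
    have hs {Γ : Ctx} (hΓ : WellFormed (S.expandCtx Γ)) (T : Tm) (s : Srt)
        (h : asSort ((infer S N k Γ T).map Prod.fst) = some s) :
        Typing (S.expandCtx Γ) (S.expand Γ.length T) (sort s) := by
      obtain ⟨p, hp, h⟩ := Option.map_eq_some_iff.1 (asSort_eq_some.1 h)
      have := (ih hΓ hp).1
      rwa [h] at this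
    unfold infer at h
    split at h
    · cases h; exact (hΓ.weaken .axm).inferred
    · cases h
    · next n =>
      split_ifs at h with hn hi
      · obtain ⟨T, h', rfl⟩ := Option.map_eq_some_iff.1 h
        exact (Typing.of_varType hΓ h').inferred
      · obtain ⟨d, hd, rfl⟩ := Option.map_eq_some_iff.1 h
        refine Typing.inferred ?_
        have := hΓ.weaken (hN _ hi d hd)
        rw [S.length_expandCtx] at this
        rw [S.expand_lift, ← Nat.sub_add_cancel (not_lt.1 hn),
          show S.expand _ (Tm.var _) = _ from liftSub_add _ _ _]
        exact this
    · obtain ⟨s, h', rfl⟩ := Option.map_eq_some_iff.1 h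
      exact (Typing.pi_of_piSort h' (hs hΓ _) fun s₁ s h₁ =>
        hs (Γ := _ :: Γ) (hΓ.cons (hs hΓ _ _ h₁)) _ s).inferred
    · next U b =>
      simp only [Option.bind_eq_bind, Option.bind_eq_some_iff] at h
      obtain ⟨⟨T, o⟩, hb, s, hpi, ⟨⟩⟩ := h
      obtain ⟨s₁, hU⟩ : ∃ s, asSort ((infer S N k Γ U).map Prod.fst) = some s := by
        cases hU : asSort ((infer S N k Γ U).map Prod.fst) with
        | none => rw [hU] at hpi; cases hpi
        | some s => exact ⟨s, rfl⟩
      have hΓ' : WellFormed (S.expandCtx (U :: Γ)) := hΓ.cons (hs hΓ _ _ hU)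
      have hb := ih hΓ' hb
      have hpi : Typing (S.expandCtx Γ) (S.expand Γ.length (Tm.pi U T)) (sort s) := by
        refine .pi_of_piSort hpi (hs hΓ _) fun _ s _ h => ?_
        -- The sort of the codomain was either returned along with the type of the body or inferred
        -- separately.
        rcases Option.or_eq_some_iff.1 h with h | ⟨_, h⟩
        · exact hb.2 s h
        · exact hs hΓ' _ s h
      exact ⟨.lam hpi hb.1, fun s' h => by cases h; exact hpi⟩
    · simp only [Option.bind_eq_bind, Option.bind_eq_some_iff] at h
      obtain ⟨F, hf, A, ha, h⟩ := h
      split at h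
      next hF =>
        split_ifs at h with hA
        cases h
        refine Typing.inferred ?_
        rw [S.expand_inst]
        exact .app ((ih hΓ hf).1.exposePi hS hF (hs hΓ)) ((ih hΓ ha).1.coerce hS hA (hs hΓ))
      next => cases h

/-- A test whether the closed term `t` has the type `T`. -/
def checks (S : Sig) (N k : ℕ) (t T : Tm) : Bool :=
  match infer S N k [] t with
  | some A => coercible S k 0 (fun T => asSort ((infer S N k [] T).map Prod.fst)) A.1 T
  | none => false

theorem Typing.of_checks {S : Sig} (hS : S.Coherent) {N : ℕ} (hN : S.Valid N) {k : ℕ} {t T : Tm}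
    (h : checks S N k t T = true) : Typing [] (S.expand 0 t) (S.expand 0 T) := by
  rw [checks] at h
  split at h
  next hA =>
    refine (inferred_of_infer hS hN (Γ := []) .nil hA).1.coerce hS h fun T s h => ?_
    obtain ⟨p, hp, h⟩ := Option.map_eq_some_iff.1 (asSort_eq_some.1 h)
    have := (inferred_of_infer hS hN (Γ := []) .nil hp).1
    rwa [h] at this
  next => cases h

/-- The constants of a signature are well-typed if each of them passes the check. -/
theorem Sig.valid_of_checks {S : Sig} (hS : S.Coherent) {k : ℕ}
    (h : ∀ i < S.length, ∀ d ∈ S[i]?, checks S i k d.body d.type = true) (N : ℕ) : S.Valid N := by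
  induction N with
  | zero => exact fun i hi => absurd hi i.not_lt_zero
  | succ N ih =>
    intro i hi d hd
    rcases Nat.lt_succ_iff_lt_or_eq.1 hi with hi | rfl
    · exact ih i hi d hd
    -- The check of constant `i` may use only the first `i` constants, so the induction is not
    -- circular.
    · rw [← hS i d hd]
      exact .of_checks hS ih (h i (List.getElem?_eq_some_iff.1 hd).1 d hd)

/-! ### The bisimulation

The terms below refer to the constants of the signature `constants`, in this order: `bool`, `true`,
`false`, `¬`, `I` (0 to 4), `Stream`, the functions that `hd` and `tl` apply (5 to 7), `s₁`, `s₂`,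
their tails `t₁`, `t₂` (8 to 11), `Stream → Stream → ⋆` (12), the family of relations `rel` with its
introduction rules (13 to 17), its symmetry and its stability (18, 19), the relation
`rel s₁ s₂ t₁ t₂` (20), its symmetry and its stability (21, 22), and the proof of `s₁ ∼ s₂` (23).
The argument `m` is the number of enclosing binders. -/

/-- `f a b c d`. -/
def app4 (f a b c d : Tm) : Tm := app2 (app2 f a b) c d

/-- `λ x₁ … xₙ : Stream. b`. -/
def lams : ℕ → ℕ → Tm → Tm
  | 0, _, b => b
  | n + 1, m, b => lam (var (m + 5)) (lams n (m + 1) b)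

/-- `Π x₁ … xₙ : Stream. B`. -/
def pis : ℕ → ℕ → Tm → Tm
  | 0, _, B => B
  | n + 1, m, B => pi (var (m + 5)) (pis n (m + 1) B)

/-- `λ a b c d x y : Stream. Π Q. Q a b → Q b a → Q c d → Q d c → Q x y`: the least relation that
holds between `a` and `b`, and between `c` and `d`, in both directions. -/
def relBody : Tm :=
  lams 6 0 (pi (var 18) (arr (app2 (var 0) (var 6) (var 5)) (arr (app2 (var 0) (var 5) (var 6))
    (arr (app2 (var 0) (var 4) (var 3)) (arr (app2 (var 0) (var 3) (var 4))
      (app2 (var 0) (var 2) (var 1)))))))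

/-- `rel a b c d`. -/
def relAt (m a b c d : ℕ) : Tm := app4 (var (m + 13)) (var a) (var b) (var c) (var d)

/-- The introduction rules of the relation `rel a b c d`. -/
def relIntro (i : ℕ) : Tm :=
  lams 4 0 (lam (var 16) (lam (app2 (var 0) (var 4) (var 3)) (lam (app2 (var 1) (var 4) (var 5))
    -- The index counts hypotheses from the last one: `0, 1, 2, 3` select the pairs `(d, c)`, `(c,
    -- d)`, `(b, a)`, `(a, b)`.
    (lam (app2 (var 2) (var 4) (var 3)) (lam (app2 (var 3) (var 4) (var 5)) (var i))))))

/-- `Π a b c d : Stream. rel a b c d x y`. -/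
def relIntroType (x y : ℕ) : Tm := pis 4 0 (app2 (relAt 4 3 2 1 0) (var x) (var y))

/-- `R` is symmetric. -/
def symmAt (m : ℕ) (R : Tm) : Tm :=
  pis 2 m (arr (app2 R.shift.shift (var 1) (var 0)) (app2 R.shift.shift (var 0) (var 1)))

/-- `hd x = hd y ∧ R (tl x) (tl y)`. -/
def stableFor (m : ℕ) (R x y : Tm) : Tm :=
  prod (leib (var m) (recEx (var m) (var (m + 6)) x) (recEx (var m) (var (m + 6)) y))
    (app2 R (recEx (var (m + 5)) (var (m + 7)) x) (recEx (var (m + 5)) (var (m + 7)) y))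

/-- `Π x y : Stream. R x y → hd x = hd y ∧ R (tl x) (tl y)`. -/
def stableAt (m : ℕ) (R : Tm) : Tm :=
  pis 2 m (arr (app2 R.shift.shift (var 1) (var 0))
    (stableFor (m + 2) R.shift.shift (var 1) (var 0)))

/-- A proof that `rel a b c d` is symmetric. -/
def relSymm : Tm :=
  lams 6 0 (lam (app2 (relAt 6 5 4 3 2) (var 1) (var 0))
    -- Eliminate into the converse relation; each rule is replaced by the one for the swapped pair.
    (app4 (app (var 0) (lams 2 7 (app2 (relAt 9 8 7 6 5) (var 0) (var 1))))
      (app4 (var 23) (var 6) (var 5) (var 4) (var 3))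
      (app4 (var 24) (var 6) (var 5) (var 4) (var 3))
      (app4 (var 21) (var 6) (var 5) (var 4) (var 3))
      (app4 (var 22) (var 6) (var 5) (var 4) (var 3))))

/-- A proof that `rel a b c d` is stable, provided that the defining pairs satisfy the condition. -/
def relStable : Tm :=
  lams 4 0 (lam (stableFor 4 (relAt 4 3 2 1 0) (var 3) (var 2))
    (lam (stableFor 5 (relAt 5 4 3 2 1) (var 3) (var 4))
    (lam (stableFor 6 (relAt 6 5 4 3 2) (var 3) (var 2))
    (lam (stableFor 7 (relAt 7 6 5 4 3) (var 3) (var 4))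
    (lams 2 8 (lam (app2 (relAt 10 9 8 7 6) (var 1) (var 0))
      -- Eliminate into the stability condition itself. It mentions `rel` rather than the predicate
      -- being eliminated into, so this is a mere case distinction on the four pairs.
      (app4 (app (var 0) (lams 2 11 (stableFor 13 (relAt 13 12 11 10 9) (var 1) (var 0))))
        (var 6) (var 5) (var 4) (var 3))))))))

/-- The type of `relStable`. -/
def relStableType : Tm :=
  pis 4 0 (pi (stableFor 4 (relAt 4 3 2 1 0) (var 3) (var 2))
    (pi (stableFor 5 (relAt 5 4 3 2 1) (var 3) (var 4))
    (pi (stableFor 6 (relAt 6 5 4 3 2) (var 3) (var 2))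
    (pi (stableFor 7 (relAt 7 6 5 4 3) (var 3) (var 4))
    (stableAt 8 (relAt 8 7 6 5 4))))))

/-- The instance of `f` for `s₁ s₂ t₁ t₂`. -/
def atStreams (f : ℕ) : Tm := app4 (var f) (var 8) (var 9) (var 10) (var 11)

/-- A proof of `b = b ∧ rel s₁ s₂ t₁ t₂ x y`, where `f` is the appropriate introduction rule. -/
def stepProof (b x y f : ℕ) : Tm :=
  pair (leib (var 0) (var b) (var b)) (app2 (var 20) (var x) (var y))
    -- Reflexivity at the boolean `b` proves equality of the heads, because both heads reduce to
    -- `b`.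
    (lam (arr (var 0) star) (lam (app (var 0) (var (b + 1))) (var 0))) (atStreams f)

/-- A proof that `rel s₁ s₂ t₁ t₂` is stable. -/
def stableProof : Tm :=
  -- The pairs of `s₁` and `s₂` have heads `false` and tails `t₁`, `t₂`; those of `t₁` and `t₂` have
  -- heads `true` and tails `s₁`, `s₂`.
  app4 (atStreams 19) (stepProof 2 10 11 15) (stepProof 2 11 10 14) (stepProof 1 8 9 17)
    (stepProof 1 9 8 16)

/-- `R` is a bisimulation that relates `s₁` and `s₂`, where `R` is the variable with index `0`. -/
def bisimBody : Tm :=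
  prod (prod (symmAt 1 (var 0)) (stableAt 1 (var 0))) (app2 (var 0) (var 9) (var 10))

/-- A proof of `s₁ ∼ s₂`. -/
def bisimProof : Tm :=
  lam star (lam (pi (var 13) (arr bisimBody.shift1 (var 1)))
    (app2 (var 0) (var 22)
      (pair (prod (symmAt 0 (var 20)) (stableAt 0 (var 20))) (app2 (var 20) (var 8) (var 9))
        (pair (symmAt 0 (var 20)) (stableAt 0 (var 20)) (var 21) (var 22))
        (atStreams 17)).shift.shift))

/-- The argument of an application. -/
def arg : Tm → Tm
  | app _ a => a
  | t => t

/-- The type of the functions that are applied to the contents of a stream to yield terms of the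
type given by the constant `i`. -/
def contType (i : ℕ) : Form → Tm
  | .paired => pi star (arr (pre (var 1) (var 0)) (var (i + 1)))
  | .curried => contC (var 0) (var i)

/-- The definitions and types of the constants. -/
def constants (e : Form) : Sig :=
  [⟨bool, star⟩, ⟨tt, var 0⟩, ⟨ff, var 0⟩, ⟨neg, arr (var 0) (var 0)⟩,
    ⟨idBool, arr (var 0) (var 0)⟩, ⟨Stream e (var 0), star⟩,
    ⟨arg (hd e (var 0) (var 0)), contType 0 e⟩, ⟨arg (tl e (var 0) (var 0)), contType 5 e⟩,
    ⟨packStream e (var 0) (var 0) (var 1) (var 3) (var 3), var 5⟩,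
    ⟨packStream e (var 0) (var 0) (var 2) (var 4) (var 3), var 5⟩,
    ⟨packStream e (var 0) (var 0) (var 2) (var 3) (var 3), var 5⟩,
    ⟨packStream e (var 0) (var 0) (var 1) (var 4) (var 3), var 5⟩,
    ⟨arr (var 5) (arr (var 5) star), sort .kind⟩, ⟨relBody, pis 4 0 (var 16)⟩,
    ⟨relIntro 0, relIntroType 0 1⟩, ⟨relIntro 1, relIntroType 1 0⟩, ⟨relIntro 2, relIntroType 2 3⟩,
    ⟨relIntro 3, relIntroType 3 2⟩, ⟨relSymm, pis 4 0 (symmAt 4 (relAt 4 3 2 1 0))⟩,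
    ⟨relStable, relStableType⟩, ⟨atStreams 13, var 12⟩, ⟨atStreams 18, symmAt 0 (var 20)⟩,
    ⟨stableProof, stableAt 0 (var 20)⟩, ⟨bisimProof, ex (var 12) bisimBody⟩]

/-! ### Checking the constants by computation -/

theorem constants_coherent (e : Form) : (constants e).Coherent :=
  Sig.coherent_of_closedAt (by cases e <;> decide +kernel)

theorem constants_checks (e : Form) : ∀ i < (constants e).length, ∀ d ∈ (constants e)[i]?,
    checks (constants e) i 100 d.body d.type = true := by
  cases e <;> decide +kernel

theorem constants_valid (e : Form) (N : ℕ) : (constants e).Valid N :=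
  Sig.valid_of_checks (constants_coherent e) (constants_checks e) N

/-- The values of the first constants. -/
def values (e : Form) : List Tm :=
  [bool, tt, ff, neg, idBool, Stream e bool, arg (hd e bool (var 0)), arg (tl e bool (var 0)), s₁ e,
    s₂ e, packStream e bool bool ff neg neg, packStream e bool bool tt idBool neg,
    arr (Stream e bool) (arr (Stream e bool) star)]

/-- Links the abbreviations to the terms of the theorem. Only the first 13 are needed: later
constants occur in proofs, not in the types to be inhabited. -/
theorem val_constants (e : Form) : ∀ i < 13, (constants e).val i = lookup (values e) i := by
  intro i
  induction i using Nat.strong_induction_on with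
  | _ i ih =>
    intro hi
    have h : ∀ i < 13, ∃ d, (constants e)[i]? = some d ∧ d.body.closedAt i = true ∧
        (d.body.subst (lookup (values e))).beq (lookup (values e) i) = true := by
      have : ∀ i < 13, ((constants e)[i]?.any fun d => d.body.closedAt i &&
          (d.body.subst (lookup (values e))).beq (lookup (values e) i)) = true := by
        cases e <;> decide +kernel
      intro i hi
      obtain ⟨d, hd, h⟩ := (Option.any_eq_true _ _).1 (this i hi)
      exact ⟨d, hd, (Bool.and_eq_true _ _).mp h⟩
    obtain ⟨d, hd, hc, hv⟩ := h i hi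
    rw [← constants_coherent e i d hd, ← Tm.eq_of_beq hv]
    exact subst_eq_of_closedAt hc fun n hn => ih n hn (hn.trans hi)

/-- Two forms of a term are equal if they are so after the expansion of the constants. -/
theorem expand_constants (e : Form) {t t' : Tm}
    (h : (t.closedAt 13 && (t.subst (lookup (values e))).beq t') = true) :
    (constants e).expand 0 t = t' := by
  obtain ⟨hc, h⟩ := (Bool.and_eq_true _ _).mp h
  rw [← Tm.eq_of_beq h]
  exact subst_eq_of_closedAt hc fun n hn => val_constants e n hn

/-- Derive a judgment about closed terms by type inference, after the introduction of constants. -/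
theorem Typing.of_constants (e : Form) {t T t' T' : Tm}
    (h : checks (constants e) (constants e).length 100 t T = true)
    (ht : (t.closedAt 13 && (t.subst (lookup (values e))).beq t') = true)
    (hT : (T.closedAt 13 && (T.subst (lookup (values e))).beq T') = true) :
    Typing [] t' T' := by
  rw [← expand_constants e ht, ← expand_constants e hT]
  exact .of_checks (constants_coherent e) (constants_valid e _) h

theorem typing_coind (e : Form) : Typing [] (coind e bool) star :=
  .of_constants e (t := coind e (var 0)) (T := star) (by cases e <;> decide +kernel)
    (by cases e <;> decide +kernel) rfl

theorem typing_s₁ (e : Form) : Typing [] (s₁ e) (Stream e bool) :=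
  .of_constants e (t := var 8) (T := var 5) (by cases e <;> decide +kernel)
    (by cases e <;> decide +kernel) (by cases e <;> decide +kernel)

theorem typing_s₂ (e : Form) : Typing [] (s₂ e) (Stream e bool) :=
  .of_constants e (t := var 9) (T := var 5) (by cases e <;> decide +kernel)
    (by cases e <;> decide +kernel) (by cases e <;> decide +kernel)

theorem typing_leib (e : Form) : Typing [] (leib (Stream e bool) (s₁ e) (s₂ e)) star :=
  .of_constants e (t := leib (var 5) (var 8) (var 9)) (T := star) (by cases e <;> decide +kernel)
    (by cases e <;> decide +kernel) rfl

theorem isInhabited_bisimilar (e : Form) : IsInhabited (bisimilar e bool (s₁ e) (s₂ e)) := by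
  have h : Typing [] ((constants e).val 23) ((constants e).expand 0 (ex (var 12) bisimBody)) :=
    constants_valid e 24 23 (Nat.lt_succ_self 23) ⟨bisimProof, ex (var 12) bisimBody⟩ rfl
  have hT : (constants e).expand 0 (ex (var 12) bisimBody) = bisimilar e bool (s₁ e) (s₂ e) :=
    expand_constants e (by cases e <;> decide +kernel)
  exact ⟨_, hT ▸ h⟩

/-! ### Inequality of the streams and failure of coinduction -/

/-- No redex occurs in the pseudo-term. -/
def Tm.isNormal : Tm → Bool
  | sort _ => true
  | var _ => true
  | pi U T => isNormal U && isNormal T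
  | lam U b => isNormal U && isNormal b
  | app (lam _ _) _ => false
  | app f a => isNormal f && isNormal a

theorem Step.isNormal_eq_false {t u : Tm} (h : Step t u) : t.isNormal = false := by
  induction h with
  | beta => rfl
  | piDom _ _ ih | piCod _ _ ih | lamDom _ _ ih | lamBody _ _ ih => simp [Tm.isNormal, ih]
  | appFun a h ih => cases h <;> simp_all [Tm.isNormal]
  | appArg f _ ih => cases f <;> simp [Tm.isNormal, ih]

theorem Red.eq_of_isNormal {t u : Tm} (h : Red t u) (ht : t.isNormal = true) : u = t := by
  induction h with
  | refl => rfl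
  | tail _ h ih => subst ih; rw [h.isNormal_eq_false] at ht; cases ht

/-- Two normal forms with a common reduct coincide, whereas these differ syntactically. -/
theorem not_betaEq_s₁_s₂ (e : Form) : ¬ BetaEq (s₁ e) (s₂ e) := by
  intro h
  obtain ⟨v, h₁, h₂⟩ := h.join
  have h₁ := h₁.eq_of_isNormal (by cases e <;> decide +kernel)
  have h₂ := h₂.eq_of_isNormal (by cases e <;> decide +kernel)
  exact absurd (h₁.symm.trans h₂) (by cases e <;> decide +kernel)

theorem not_isInhabited_leib (e : Form) :
    ¬ IsInhabited (leib (Stream e bool) (s₁ e) (s₂ e)) := fun h =>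
  not_betaEq_s₁_s₂ e (betaEq_of_isInhabited_leib (fun s => by cases e <;> rfl)
    (fun s => by cases e <;> rfl) h)

theorem Tm.shift_inst (t a : Tm) : t.shift.inst a = t := by
  rw [inst, shift, subst_rename]
  exact subst_var t

theorem isInhabited_leib_of_coind {e : Form} (h : IsInhabited (coind e bool)) :
    IsInhabited (leib (Stream e bool) (s₁ e) (s₂ e)) := by
  obtain ⟨M, hM⟩ := h
  obtain ⟨p, hp⟩ := isInhabited_bisimilar e
  -- Keeping the codomain abstract confines the computation of the two instantiations to a single
  -- Boolean comparison.
  obtain ⟨B, hB, hB'⟩ : ∃ B, coind e bool = pi (Stream e bool) (pi (Stream e bool).shift B) ∧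
      (B.subst (upSub (single (s₁ e)))).inst (s₂ e) =
        arr (bisimilar e bool (s₁ e) (s₂ e)) (leib (Stream e bool) (s₁ e) (s₂ e)) :=
    ⟨_, rfl, Tm.eq_of_beq (by cases e <;> decide +kernel)⟩
  rw [hB] at hM
  have h := hM.app (typing_s₁ e)
  change Typing [] _ (pi ((Stream e bool).shift.inst _) _) at h
  rw [shift_inst] at h
  have h := h.app (typing_s₂ e)
  rw [hB'] at h
  have h := Typing.app h hp
  rw [shift_inst] at h
  exact ⟨_, h⟩

end LP2

theorem mainTheorem1 (e : LP2.Form) :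
    -- the types and streams in question are well-formed closed expressions
    LP2.Typing [] (LP2.coind e LP2.bool) LP2.star ∧
    LP2.Typing [] (LP2.s₁ e) (LP2.Stream e LP2.bool) ∧
    LP2.Typing [] (LP2.s₂ e) (LP2.Stream e LP2.bool) ∧
    LP2.Typing [] (LP2.leib (LP2.Stream e LP2.bool) (LP2.s₁ e) (LP2.s₂ e)) LP2.star ∧
    -- there is no coinduction principle for streams of booleans
    ¬ LP2.IsInhabited (LP2.coind e LP2.bool) ∧
    -- the two streams are bisimilar, but not Leibniz equal
    LP2.IsInhabited (LP2.bisimilar e LP2.bool (LP2.s₁ e) (LP2.s₂ e)) ∧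
    ¬ LP2.IsInhabited (LP2.leib (LP2.Stream e LP2.bool) (LP2.s₁ e) (LP2.s₂ e)) :=
  ⟨LP2.typing_coind e, LP2.typing_s₁ e, LP2.typing_s₂ e, LP2.typing_leib e,
    fun h => LP2.not_isInhabited_leib e (LP2.isInhabited_leib_of_coind h),
    LP2.isInhabited_bisimilar e, LP2.not_isInhabited_leib e⟩
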